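/- Let $\Omega\subset\mathbb{R}^2$ be a bounded open set whose boundary is a finite union of $C^1$ Jordan curves (simple closed curves with a regular $C^1$ parametrization). Let $f\in L^1(\Omega)$ be real-valued and let $u$ be the solution of $$\Delta u=f\ \text{ in }\Omega,\qquad u=0\ \text{ on }\partial\Omega ,$$ in the usual very weak (duality) sense for integrable data: $u\in L^1(\Omega)$ and $$\int_\Omega u\,\Delta\varphi\,dx=\int_\Omega f\,\varphi\,dx$$ for all $\varphi\in C^2(\Omega)\cap C(\overline\Omega)$ with $\varphi=0$ on $\partial\Omega$ and $\Delta\varphi$ bounded in $\Omega$. Then the distributional gradient $\nabla u$ is a locally integrable function on $\Omega$, it belongs to the Lorentz space $L^{2,\infty}(\Omega)$, and $$\|\nabla u\|_{L^{2,\infty}(\Omega)}\le 3\sqrt{\frac{2}{\pi}}\,\|f\|_{L^1(\Omega)} .$$ In particular the constant does not depend on $\Omega$. Here $$\|g\|_{L^{2,\infty}(\Omega)}=\sup_{t>0}\,t^{1/2}g^{**}(t),\qquad g^{**}(t)=\frac1t\int_0^t g^*(s)\,ds,\qquad g^*(s)=\inf\{\lambda\ge0:\ |\{x\in\Omega:|g(x)|>\lambda\}|\le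 s\},$$ and $L^{2,\infty}(\Omega)$ is the space of measurable $g$ for which this norm is finite. -/

import Mathlib

open MeasureTheory Set
open scoped ENNReal ContDiff InnerProductSpace Gradient

/-- The Euclidean plane `ℝ²`, with Euclidean norm and Lebesgue measure. -/
abbrev Plane : Type := EuclideanSpace ℝ (Fin 2)

/-- `Γ` is a `C¹` Jordan curve: the trace of a simple closed curve with a regular `C¹`
(periodic) parametrization. -/
def IsC1JordanCurve (Γ : Set Plane) : Prop :=
  ∃ γ : ℝ → Plane, ContDiff ℝ 1 γ ∧ Function.Periodic γ 1 ∧ InjOn γ (Ico 0 1) ∧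
    (∀ t, deriv γ t ≠ 0) ∧ range γ = Γ

/-- Test functions for the Dirichlet problem in `Ω`: functions in `C²(Ω) ∩ C(closure Ω)` that
vanish on the boundary and have bounded Laplacian in `Ω`. -/
structure IsDirichletTest (Ω : Set Plane) (φ : Plane → ℝ) : Prop where
  continuousOn : ContinuousOn φ (closure Ω)
  contDiffOn : ContDiffOn ℝ 2 φ Ω
  boundary : ∀ x ∈ frontier Ω, φ x = 0
  bounded_laplacian : ∃ C : ℝ, ∀ x ∈ Ω, |Laplacian.laplacian φ x| ≤ C

/-- `u` is the (very weak) solution of `Δ u = f` in `Ω`, `u = 0` on `∂Ω`, for an integrable `f`: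
`u ∈ L¹(Ω)` and `∫_Ω u Δφ = ∫_Ω f φ` for all `φ ∈ C²(Ω) ∩ C(closure Ω)` which vanish on `∂Ω` and
have bounded Laplacian. Functions `φ` with compact support in `Ω` give `Δ u = f` in the sense
of distributions; the boundary condition `u = 0` is encoded by testing with functions `φ` whose
normal derivative need not vanish on `∂Ω`. -/
structure IsDirichletSolution (Ω : Set Plane) (f u : Plane → ℝ) : Prop where
  integrableOn : IntegrableOn u Ω volume
  integral_eq : ∀ φ : Plane → ℝ, IsDirichletTest Ω φ →
    ∫ x in Ω, u x * Laplacian.laplacian φ x = ∫ x in Ω, f x * φ x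

/-- `G` is the weak (distributional) gradient of `u` in `Ω`. -/
structure HasWeakGradient (Ω : Set Plane) (u : Plane → ℝ) (G : Plane → Plane) : Prop where
  locallyIntegrableOn : LocallyIntegrableOn u Ω volume
  locallyIntegrableOn_grad : LocallyIntegrableOn G Ω volume
  integral_eq : ∀ φ : Plane → ℝ, ContDiff ℝ ∞ φ → HasCompactSupport φ → tsupport φ ⊆ Ω →
    ∫ x in Ω, u x • ∇ φ x = -∫ x in Ω, φ x • G x

section Lorentz

variable {α : Type*} [MeasurableSpace α] {F : Type*} [NormedAddCommGroup F]

/-- Decreasing rearrangement `g^*(t) = inf {s ≥ 0 : μ {|g| > s} ≤ t}`. -/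
noncomputable def decreasingRearrangement (g : α → F) (μ : Measure α) (t : ℝ) : ℝ≥0∞ :=
  sInf {s : ℝ≥0∞ | μ {x | s < ‖g x‖ₑ} ≤ ENNReal.ofReal t}

/-- Maximal rearrangement `g^{**}(t) = (1/t) ∫_0^t g^*(s) ds`, for `t > 0`. -/
noncomputable def maximalRearrangement (g : α → F) (μ : Measure α) (t : ℝ) : ℝ≥0∞ :=
  (∫⁻ s in Ioo (0 : ℝ) t, decreasingRearrangement g μ s) / ENNReal.ofReal t

/-- The norm of the Lorentz space `L^{2,∞}`: `‖g‖_{2,∞} = sup_{t > 0} t^{1/2} g^{**}(t)`. -/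
noncomputable def lorentzTwoInftyNorm (g : α → F) (μ : Measure α) : ℝ≥0∞ :=
  ⨆ t : ℝ, ⨆ _ : 0 < t, ENNReal.ofReal (√t) * maximalRearrangement g μ t

/-- Membership in the Lorentz space `L^{2,∞}(μ)`. -/
def MemLorentzTwoInfty (g : α → F) (μ : Measure α) : Prop :=
  AEStronglyMeasurable g μ ∧ lorentzTwoInftyNorm g μ < ⊤

end Lorentz

/-! Extended by zero, `u` has as Laplacian on the whole plane a difference of two finite measures,
each of mass `‖f‖₁`. Indeed, if `φ` is `C²` on the plane and `h` is harmonic in `Ω` with `h = φ` on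
the boundary, then `φ - h` is an admissible test function and `∫ u Δφ = ∫ f φ - ∫ f h`. By the
maximum principle and Riesz representation, `h ↦ ∫ f^± h` is integration of `φ` against a positive
measure on the boundary of mass `∫ f^±`, the balayage of `f^±`. Hence `Δu = μ - ν`, where `μ` is
`f⁺` plus the balayage of `f⁻` and `ν` is `f⁻` plus the balayage of `f⁺`
(`IsDirichletSolution.exists_measures`).

The gradient is then `K * μ - K * ν` with `K(z) = z / (2π|z|²)`. This is seen by testing with
`gradConv a φ`, the convolution of `φ` with `⟨a, K⟩`, whose Laplacian is `∂_a φ`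
(`laplacian_gradConv`). Among sets of given area a disc maximizes the integral of `|K|`, so `∫_E
|K(y - x)| dy ≤ √(|E|/π)` and `∫_E |∇u| ≤ 2‖f‖₁ √(|E|/π)`. Passing to the rearrangement through
level sets costs a factor 2 and gives the constant `4/√π`, which is at most `3√(2/π)`.

The remaining ingredient is the solvability of the Dirichlet problem for all continuous boundary
data. It is obtained by Poincaré's sweeping for subharmonic data, barriers from a square root, and
lattice density of differences of subharmonic functions. The barriers use only that the boundary
curve is locally a Lipschitz graph avoiding `Ω`; the side on which `Ω` lies is irrelevant. -/

/-! ### Poisson integrals on a disc: harmonicity and boundary values. -/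

section PoissonIntegral

open Metric Filter Topology Real InnerProductSpace

/-- The Poisson integral over the circle `sphere c R` of a function `v`. -/
noncomputable def poissonIntegral (v : ℂ → ℝ) (c : ℂ) (R : ℝ) (w : ℂ) : ℝ :=
  circleAverage (poissonKernel c w • v) c R

lemma poissonKernel_nonneg_of_mem {c w z : ℂ} {R : ℝ} (hw : w ∈ ball c R) (hz : z ∈ sphere c R) :
    0 ≤ poissonKernel c w z := by
  rw [poissonKernel_def]
  have h1 : ‖w - c‖ < R := by simpa [dist_eq_norm] using hw
  have h2 : ‖z - c‖ = R := by simpa [dist_eq_norm] using hz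
  rw [h2]
  apply div_nonneg _ (by positivity)
  nlinarith [norm_nonneg (w - c)]

lemma continuousOn_poissonKernel_sphere {c w : ℂ} {R : ℝ} (hw : w ∈ ball c R) :
    ContinuousOn (poissonKernel c w) (sphere c |R|) := by
  rw [poissonKernel_eq_re_herglotzRieszKernel]
  exact Complex.continuous_re.comp_continuousOn (continuousOn_herglotzRieszKernel_sphere hw)

lemma circleIntegrable_poissonKernel_smul {v : ℂ → ℝ} {c w : ℂ} {R : ℝ}
    (hv : CircleIntegrable v c R) (hw : w ∈ ball c R) :
    CircleIntegrable (poissonKernel c w • v) c R :=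
  hv.continuousOn_smul (continuousOn_poissonKernel_sphere hw)

lemma poissonIntegral_mono {v v' : ℂ → ℝ} {c w : ℂ} {R : ℝ} (hv : CircleIntegrable v c R)
    (hv' : CircleIntegrable v' c R) (hw : w ∈ ball c R) (h : ∀ z ∈ sphere c R, v z ≤ v' z) :
    poissonIntegral v c R w ≤ poissonIntegral v' c R w := by
  have hR : 0 < R := pos_of_mem_ball hw
  refine circleAverage_mono (circleIntegrable_poissonKernel_smul hv hw)
    (circleIntegrable_poissonKernel_smul hv' hw) fun z hz => ?_
  rw [abs_of_pos hR] at hz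
  exact mul_le_mul_of_nonneg_left (h z hz) (poissonKernel_nonneg_of_mem hw hz)

lemma poissonIntegral_eq_of_harmonic {v : ℂ → ℝ} {c w : ℂ} {R : ℝ}
    (hv : HarmonicContOnCl v (ball c R)) (hw : w ∈ ball c R) : poissonIntegral v c R w = v w :=
  hv.circleAverage_poissonKernel_smul hw

/-- The Poisson kernel is the real part of the Herglotz–Riesz kernel, so the integral is the real
part of a holomorphic function of `w`. Mere integrability of `v` suffices, which matters later for
pointwise limits not yet known to be continuous. -/
lemma harmonicAt_poissonIntegral {v : ℂ → ℝ} {c w : ℂ} {R : ℝ} (hv : CircleIntegrable v c R)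
    (hw : w ∈ ball c R) : HarmonicAt (poissonIntegral v c R) w := by
  set g : ℂ → ℝ := fun z => v (z + c) with hg
  have hgI : CircleIntegrable g 0 R := by
    simpa [CircleIntegrable, hg, circleMap, add_comm] using (show IntervalIntegrable _ _ _ _ from hv)
  have hgI' : CircleIntegrable (fun z => (g z : ℂ)) 0 R := by
    have := Complex.ofRealCLM.integrable_comp (show Integrable _ _ from hgI.1)
    have h2 := Complex.ofRealCLM.integrable_comp (show Integrable _ _ from hgI.2)
    exact ⟨this, h2⟩
  have hA := analyticOnNhd_circleAverage_herglotzRieszKernel_smul hgI'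
  have hwc : w - c ∈ ball (0 : ℂ) R := by simpa [dist_eq_norm] using hw
  have hA' : AnalyticAt ℂ (fun w => circleAverage
      (fun ζ ↦ herglotzRieszKernel 0 (w - c) ζ • (g ζ : ℂ)) 0 R) w :=
    AnalyticAt.fun_comp (g := fun w => circleAverage
      (fun ζ ↦ herglotzRieszKernel 0 w ζ • (g ζ : ℂ)) 0 R) (hA _ hwc)
      (analyticAt_id.sub analyticAt_const)
  refine (harmonicAt_congr_nhds ?_).1 hA'.harmonicAt_re
  filter_upwards [isOpen_ball.mem_nhds hw] with x hx
  have hxc : x - c ∈ ball (0 : ℂ) R := by simpa [dist_eq_norm] using hx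
  rw [re_circleAverage_herglotzRieszKernel_smul hgI hxc, poissonIntegral,
    poissonKernel_eq_re_herglotzRieszKernel, ← circleAverage_map_add_const (c := c)]
  congr 1
  ext z
  simp [hg, herglotzRieszKernel_add_const]

/-- The function that agrees with `v` off the ball and with the Poisson integral of `v` in the
ball. -/
noncomputable def poissonExt (v : ℂ → ℝ) (c : ℂ) (R : ℝ) (w : ℂ) : ℝ :=
  open Classical in if w ∈ ball c R then poissonIntegral v c R w else v w

lemma poissonExt_of_mem {v : ℂ → ℝ} {c w : ℂ} {R : ℝ} (hw : w ∈ ball c R) :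
    poissonExt v c R w = poissonIntegral v c R w := if_pos hw

lemma poissonExt_of_notMem {v : ℂ → ℝ} {c w : ℂ} {R : ℝ} (hw : w ∉ ball c R) :
    poissonExt v c R w = v w := if_neg hw

lemma harmonicAt_poissonExt {v : ℂ → ℝ} {c w : ℂ} {R : ℝ} (hv : CircleIntegrable v c R)
    (hw : w ∈ ball c R) : HarmonicAt (poissonExt v c R) w := by
  refine (harmonicAt_congr_nhds ?_).1 (harmonicAt_poissonIntegral hv hw)
  filter_upwards [isOpen_ball.mem_nhds hw] with x hx
  rw [poissonExt_of_mem hx]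

/-- The function `z ↦ 2R² - 2 Re((z-c) conj(a-c))`, equal to `‖z - a‖²` on the circle. -/
lemma exists_harmonic_eq_sq_dist {c a : ℂ} {R : ℝ} (ha : a ∈ sphere c R) :
    ∃ H : ℂ → ℝ, Continuous H ∧ (∀ z, HarmonicAt H z) ∧ H a = 0 ∧
      ∀ z ∈ sphere c R, H z = ‖z - a‖ ^ 2 := by
  set b : ℂ := (starRingEnd ℂ) (a - c)
  have hb : (a - c) * b = (R ^ 2 : ℝ) := by
    have : ‖a - c‖ = R := by simpa [dist_eq_norm] using ha
    rw [Complex.mul_conj, Complex.normSq_eq_norm_sq, this]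
  refine ⟨fun z => (2 * (R : ℂ) ^ 2 - 2 * ((z - c) * b)).re, by fun_prop, fun z => ?_, ?_, ?_⟩
  · apply AnalyticAt.harmonicAt_re
    fun_prop
  · simp only [hb]; norm_num
  · intro z hz
    have hz' : ‖z - c‖ = R := by simpa [dist_eq_norm] using hz
    have ha' : ‖a - c‖ = R := by simpa [dist_eq_norm] using ha
    have : z - a = (z - c) - (a - c) := by ring
    rw [this, ← Complex.normSq_eq_norm_sq, Complex.normSq_sub, Complex.normSq_eq_norm_sq,
      Complex.normSq_eq_norm_sq, hz', ha']
    have h3 : (2 * (R : ℂ) ^ 2).re = 2 * R ^ 2 := by norm_cast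
    have h4 : (2 * ((z - c) * b)).re = 2 * ((z - c) * b).re := by simp [Complex.mul_re]
    simp only [Complex.sub_re (2 * (R : ℂ) ^ 2), h3, h4, b]
    ring

/-- On the circle `v` lies between `v a ± (ε/2 + C‖z - a‖²)`, and there `‖z - a‖²` coincides with a
globally harmonic `H` vanishing at `a`. The Poisson integral reproduces these harmonic bounds, so no
estimate of the kernel is needed. -/
lemma tendsto_poissonIntegral {v : ℂ → ℝ} {c a : ℂ} {R : ℝ} (hR : 0 < R)
    (hv : ContinuousOn v (sphere c R)) (ha : a ∈ sphere c R) :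
    Tendsto (poissonIntegral v c R) (𝓝[ball c R] a) (𝓝 (v a)) := by
  have hint : ∀ {g : ℂ → ℝ}, ContinuousOn g (sphere c R) → CircleIntegrable g c R :=
    fun h => h.circleIntegrable hR.le
  obtain ⟨H, Hc, Hh, Ha, HS⟩ := exists_harmonic_eq_sq_dist ha
  obtain ⟨M, hM⟩ := (isCompact_sphere c R).exists_bound_of_continuousOn hv
  have hM0 : 0 ≤ M := (norm_nonneg _).trans (hM a ha)
  rw [Metric.tendsto_nhds]
  intro ε hε
  obtain ⟨δ, hδ, hδv⟩ := Metric.continuousOn_iff.1 hv a ha (ε / 2) (half_pos hε)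
  -- Chosen so that `C‖z - a‖² ≥ 2M ≥ |v z - v a|` as soon as `‖z - a‖ ≥ δ`.
  set C : ℝ := 2 * M / δ ^ 2
  have hC : 0 ≤ C := by positivity
  have key : ∀ z ∈ sphere c R, |v z - v a| ≤ ε / 2 + C * H z := by
    intro z hz
    rw [HS z hz]
    by_cases hd : dist z a < δ
    · have := hδv z hz hd
      rw [Real.dist_eq] at this
      have : 0 ≤ C * ‖z - a‖ ^ 2 := by positivity
      linarith
    · rw [not_lt, dist_eq_norm] at hd
      have h1 : |v z - v a| ≤ 2 * M := by
        have := hM z hz; have := hM a ha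
        rw [Real.norm_eq_abs] at *
        calc |v z - v a| ≤ |v z| + |v a| := abs_sub _ _
          _ ≤ _ := by linarith
      have h2 : 2 * M ≤ C * ‖z - a‖ ^ 2 := by
        have : 2 * M = C * δ ^ 2 := by simp only [C]; field_simp
        rw [this]; gcongr
      linarith
  have hlim : Tendsto (fun w => ε / 2 + C * H w) (𝓝[ball c R] a) (𝓝 (ε / 2)) := by
    have : Tendsto (fun w => ε / 2 + C * H w) (𝓝 a) (𝓝 (ε / 2 + C * H a)) :=
      (by fun_prop : Continuous fun w => ε / 2 + C * H w).tendsto a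
    rw [Ha, mul_zero, add_zero] at this
    exact this.mono_left nhdsWithin_le_nhds
  filter_upwards [hlim.eventually_lt_const (half_lt_self hε), self_mem_nhdsWithin] with w hw hwb
  have harm : ∀ s t : ℝ, HarmonicContOnCl (fun z => s + t * H z) (ball c R) := by
    intro s t
    refine ⟨fun z _ => ?_, by fun_prop⟩
    have h := (harmonicOnNhd_const s (s := univ) z (mem_univ _)).add ((Hh z).const_smul (c := t))
    exact h
  have hup := poissonIntegral_mono (v := v) (v' := fun z => (v a + ε / 2) + C * H z) (hint hv)
    (hint (by fun_prop)) hwb fun z hz => by have := (abs_le.1 (key z hz)).2; linarith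
  have hlo := poissonIntegral_mono (v' := v) (v := fun z => (v a - ε / 2) + (-C) * H z)
    (hint (by fun_prop)) (hint hv) hwb fun z hz => by
      have := (abs_le.1 (key z hz)).1; linarith
  rw [poissonIntegral_eq_of_harmonic (harm _ _) hwb] at hup hlo
  rw [Real.dist_eq, abs_lt]
  constructor <;> linarith

lemma continuousOn_poissonExt {v : ℂ → ℝ} {c : ℂ} {R : ℝ} {U : Set ℂ} (hR : 0 < R)
    (hU : IsOpen U) (hB : closedBall c R ⊆ U) (hv : ContinuousOn v U) :
    ContinuousOn (poissonExt v c R) U := by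
  have hS : ContinuousOn v (sphere c R) := hv.mono (sphere_subset_closedBall.trans hB)
  intro x hx
  apply ContinuousAt.continuousWithinAt
  by_cases hxb : x ∈ ball c R
  · exact (harmonicAt_poissonExt (hS.circleIntegrable hR.le) hxb).1.continuousAt
  have hvx : ContinuousAt v x := hv.continuousAt (hU.mem_nhds hx)
  rw [ContinuousAt, poissonExt_of_notMem hxb, ← nhdsWithin_univ, ← union_compl_self (ball c R),
    nhdsWithin_union, tendsto_sup]
  constructor
  · by_cases hxs : x ∈ sphere c R
    · refine (tendsto_poissonIntegral hR hS hxs).congr' ?_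
      filter_upwards [self_mem_nhdsWithin] with w hw
      rw [poissonExt_of_mem hw]
    · have : x ∉ closedBall c R := by
        rw [← ball_union_sphere]
        exact fun h => h.elim hxb hxs
      have h0 : 𝓝[ball c R] x = ⊥ := by
        rw [← notMem_closure_iff_nhdsWithin_eq_bot]
        exact fun h => this (closure_ball_subset_closedBall h)
      rw [h0]; exact tendsto_bot
  · refine (hvx.tendsto.mono_left nhdsWithin_le_nhds).congr' ?_
    filter_upwards [self_mem_nhdsWithin] with w hw
    rw [poissonExt_of_notMem hw]

end PoissonIntegral

/-! ### Continuous subharmonic functions, the maximum principle and Poincaré sweeping. -/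

section Subharmonic

open Metric Filter Topology Real InnerProductSpace

/-- Continuous functions with the sub-mean value property on small circles. -/
structure IsSubharmonicOn (v : ℂ → ℝ) (U : Set ℂ) : Prop where
  continuousOn : ContinuousOn v U
  le_circleAverage : ∀ x ∈ U, ∀ᶠ r in 𝓝[>] (0 : ℝ), v x ≤ circleAverage v x r

variable {U D : Set ℂ} {v w : ℂ → ℝ}

lemma eventually_closedBall_subset_of_isOpen (hU : IsOpen U) {x : ℂ} (hx : x ∈ U) :
    ∀ᶠ r in 𝓝[>] (0 : ℝ), 0 < r ∧ closedBall x r ⊆ U :=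
  (eventually_mem_nhdsWithin (s := Ioi (0 : ℝ))).and
    ((eventually_closedBall_subset (hU.mem_nhds hx)).filter_mono nhdsWithin_le_nhds)

lemma circleIntegrable_of_closedBall_subset {x : ℂ} {r : ℝ} (hv : ContinuousOn v U) (hr : 0 < r)
    (h : closedBall x r ⊆ U) : CircleIntegrable v x r :=
  (hv.mono (sphere_subset_closedBall.trans h)).circleIntegrable hr.le

lemma IsSubharmonicOn.mono (hv : IsSubharmonicOn v U) (h : D ⊆ U) : IsSubharmonicOn v D :=
  ⟨hv.1.mono h, fun x hx => hv.2 x (h hx)⟩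

lemma IsSubharmonicOn.add (hU : IsOpen U) (hv : IsSubharmonicOn v U) (hw : IsSubharmonicOn w U) :
    IsSubharmonicOn (fun z => v z + w z) U := by
  refine ⟨hv.1.add hw.1, fun x hx => ?_⟩
  filter_upwards [hv.2 x hx, hw.2 x hx, eventually_closedBall_subset_of_isOpen hU hx]
    with r h1 h2 h3
  rw [circleAverage_fun_add (circleIntegrable_of_closedBall_subset hv.1 h3.1 h3.2)
    (circleIntegrable_of_closedBall_subset hw.1 h3.1 h3.2)]
  exact add_le_add h1 h2

lemma IsSubharmonicOn.sup (hU : IsOpen U) (hv : IsSubharmonicOn v U) (hw : IsSubharmonicOn w U) :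
    IsSubharmonicOn (fun z => max (v z) (w z)) U := by
  have hc := hv.1.sup hw.1
  refine ⟨hc, fun x hx => ?_⟩
  filter_upwards [hv.2 x hx, hw.2 x hx, eventually_closedBall_subset_of_isOpen hU hx]
    with r h1 h2 h3
  refine max_le (h1.trans ?_) (h2.trans ?_)
  · exact circleAverage_mono (circleIntegrable_of_closedBall_subset hv.1 h3.1 h3.2)
      (circleIntegrable_of_closedBall_subset hc h3.1 h3.2) fun z _ => le_max_left _ _
  · exact circleAverage_mono (circleIntegrable_of_closedBall_subset hw.1 h3.1 h3.2)
      (circleIntegrable_of_closedBall_subset hc h3.1 h3.2) fun z _ => le_max_right _ _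

lemma IsSubharmonicOn.const_mul (hv : IsSubharmonicOn v U) {a : ℝ} (ha : 0 ≤ a) :
    IsSubharmonicOn (fun z => a * v z) U := by
  refine ⟨continuousOn_const.mul hv.1, fun x hx => ?_⟩
  filter_upwards [hv.2 x hx] with r h1
  have := circleAverage_fun_smul (f := v) (c := x) (R := r) (a := a)
  simp only [smul_eq_mul] at this
  rw [this]
  gcongr

/-- The sub-mean inequality is required only for small radii, so it is a local property; this allows
barriers to be glued. -/
lemma IsSubharmonicOn.of_eqOn_nhds
    (h : ∀ x ∈ U, ∃ V ∈ 𝓝 x, ∃ v', IsSubharmonicOn v' V ∧ EqOn v v' V) : IsSubharmonicOn v U := by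
  refine ⟨fun x hx => ?_, fun x hx => ?_⟩
  · obtain ⟨V, hV, v', hv', he⟩ := h x hx
    exact ((hv'.1.continuousAt hV).congr
      (Filter.eventuallyEq_of_mem hV he).symm).continuousWithinAt
  · obtain ⟨V, hV, v', hv', he⟩ := h x hx
    filter_upwards [hv'.2 x (mem_of_mem_nhds hV), self_mem_nhdsWithin,
      (eventually_closedBall_subset hV).filter_mono nhdsWithin_le_nhds] with r h1 h2 h3
    rw [he (mem_of_mem_nhds hV), circleAverage_congr_sphere (f₂ := v')]
    · exact h1
    · rw [abs_of_pos h2]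
      exact fun z hz => he (h3 (sphere_subset_closedBall hz))

lemma isSubharmonicOn_of_harmonic (hU : IsOpen U) (hv : HarmonicOnNhd v U) :
    IsSubharmonicOn v U := by
  refine ⟨hv.continuousOn, fun x hx => ?_⟩
  filter_upwards [eventually_closedBall_subset_of_isOpen hU hx] with r h3
  refine (InnerProductSpace.HarmonicOnNhd.circleAverage_eq (hv.mono ?_)).ge
  rw [abs_of_pos h3.1]; exact h3.2

lemma isSubharmonicOn_neg_of_harmonic (hU : IsOpen U) (hv : HarmonicOnNhd v U) :
    IsSubharmonicOn (fun z => - v z) U :=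
  isSubharmonicOn_of_harmonic hU hv.neg

lemma isSubharmonicOn_const (hU : IsOpen U) (a : ℝ) : IsSubharmonicOn (fun _ => a) U :=
  isSubharmonicOn_of_harmonic hU (harmonicOnNhd_const a)

/-- **Maximum principle.** -/
theorem IsSubharmonicOn.le_of_frontier (hv : IsSubharmonicOn v D) (hD : IsOpen D)
    (hb : Bornology.IsBounded D) (hc : ContinuousOn v (closure D)) {M : ℝ}
    (hM : ∀ z ∈ frontier D, v z ≤ M) : ∀ z ∈ closure D, v z ≤ M := by
  have hK : IsCompact (closure D) := hb.isCompact_closure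
  by_contra! hcon
  obtain ⟨x0, hx0, hx0M⟩ := hcon
  obtain ⟨x1, hx1, hmax⟩ := hK.exists_isMaxOn ⟨x0, hx0⟩ hc
  set m := v x1
  have hmM : M < m := hx0M.trans_le (hmax hx0)
  have hSc : IsCompact (closure D ∩ v ⁻¹' {m}) :=
    hK.of_isClosed_subset (hc.preimage_isClosed_of_isClosed isClosed_closure isClosed_singleton)
      inter_subset_left
  -- Among all maximum points, take one with the largest real part. On any small circle around it
  -- the rightmost point is no longer a maximum point, so the circle average is strictly below `m`.
  -- Connectedness is not needed.
  obtain ⟨z, ⟨hzK, hzm⟩, hzmax⟩ := hSc.exists_isMaxOn ⟨x1, hx1, rfl⟩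
    Complex.continuous_re.continuousOn
  have hzm : v z = m := hzm
  have hzD : z ∈ D := by
    by_contra h
    have : z ∈ frontier D := by rw [hD.frontier_eq]; exact ⟨hzK, h⟩
    exact absurd (hM z this) (by rw [hzm]; exact not_le.2 hmM)
  obtain ⟨r, hr1, hr0, hr2⟩ :=
    ((hv.2 z hzD).and (eventually_closedBall_subset_of_isOpen hD hzD)).exists
  have hmem : ∀ θ, circleMap z r θ ∈ D := fun θ =>
    hr2 (sphere_subset_closedBall (circleMap_mem_sphere z hr0.le θ))
  have hcont : Continuous fun θ => v (circleMap z r θ) :=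
    hv.1.comp_continuous (continuous_circleMap z r) hmem
  have hlt : ∫ θ in (0)..2 * π, v (circleMap z r θ) < ∫ θ in (0)..2 * π, m := by
    refine intervalIntegral.integral_lt_integral_of_continuousOn_of_le_of_exists_lt two_pi_pos
      hcont.continuousOn continuousOn_const (fun θ _ => hmax (subset_closure (hmem θ)))
      ⟨0, by simp [two_pi_pos.le], lt_of_le_of_ne (hmax (subset_closure (hmem 0))) fun h => ?_⟩
    have := hzmax (show circleMap z r 0 ∈ _ from ⟨subset_closure (hmem 0), h⟩)
    simp [circleMap] at this
    linarith
  have : circleAverage v z r < m := by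
    rw [circleAverage_def, smul_eq_mul]
    rw [intervalIntegral.integral_const, smul_eq_mul, sub_zero] at hlt
    have h2 := two_pi_pos
    rw [inv_mul_lt_iff₀ h2]
    exact hlt
  rw [hzm] at hr1
  linarith

lemma harmonicOnNhd_poissonExt {c : ℂ} {R : ℝ} (hR : 0 < R)
    (hB : closedBall c R ⊆ U) (hv : ContinuousOn v U) :
    HarmonicOnNhd (poissonExt v c R) (ball c R) := fun _ hx =>
  harmonicAt_poissonExt (circleIntegrable_of_closedBall_subset hv hR hB) hx

/-- In the disc, `v` minus its Poisson integral is subharmonic and vanishes on the circle; the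
maximum principle applies. -/
lemma IsSubharmonicOn.le_poissonExt (hv : IsSubharmonicOn v U) (hU : IsOpen U) {c : ℂ} {R : ℝ}
    (hR : 0 < R) (hB : closedBall c R ⊆ U) (z : ℂ) : v z ≤ poissonExt v c R z := by
  by_cases hz : z ∈ ball c R
  swap
  · rw [poissonExt_of_notMem hz]
  have hcl := closure_ball c hR.ne'
  have hs : IsSubharmonicOn (fun z => v z + - poissonExt v c R z) (ball c R) :=
    (hv.mono (ball_subset_closedBall.trans hB)).add isOpen_ball
      (isSubharmonicOn_neg_of_harmonic isOpen_ball (harmonicOnNhd_poissonExt hR hB hv.1))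
  have := hs.le_of_frontier (M := 0) isOpen_ball isBounded_ball (by
    rw [hcl]
    exact (hv.1.mono hB).add ((continuousOn_poissonExt hR hU hB hv.1).mono hB).neg)
    (fun x hx => by
      rw [frontier_ball c hR.ne'] at hx
      rw [poissonExt_of_notMem (by simp only [mem_ball, mem_sphere.1 hx, lt_irrefl, not_false_eq_true])]; simp) z (subset_closure hz)
  linarith

lemma poissonExt_le_of_superharmonic (hv : ContinuousOn v U) (hU : IsOpen U) {c : ℂ} {R : ℝ}
    (hR : 0 < R) (hB : closedBall c R ⊆ U) (hw : IsSubharmonicOn (fun z => - w z) U)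
    (hvw : ∀ z ∈ U, v z ≤ w z) : ∀ z ∈ U, poissonExt v c R z ≤ w z := by
  intro z hzU
  by_cases hz : z ∈ ball c R
  swap
  · rw [poissonExt_of_notMem hz]; exact hvw z hzU
  have hcl := closure_ball c hR.ne'
  have hs : IsSubharmonicOn (fun z => poissonExt v c R z + - w z) (ball c R) :=
    (isSubharmonicOn_of_harmonic isOpen_ball (harmonicOnNhd_poissonExt hR hB hv)).add isOpen_ball
      (hw.mono (ball_subset_closedBall.trans hB))
  have := hs.le_of_frontier (M := 0) isOpen_ball isBounded_ball (by
    rw [hcl]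
    exact ((continuousOn_poissonExt hR hU hB hv).mono hB).add (hw.1.mono hB))
    (fun x hx => by
      rw [frontier_ball c hR.ne'] at hx
      rw [poissonExt_of_notMem (by simp only [mem_ball, mem_sphere.1 hx, lt_irrefl, not_false_eq_true])]
      have := hvw x (hB (sphere_subset_closedBall hx))
      linarith) z (subset_closure hz)
  linarith

/-- At a point off the disc the value is unchanged while circle averages can only grow. -/
lemma IsSubharmonicOn.poissonExt (hv : IsSubharmonicOn v U) (hU : IsOpen U) {c : ℂ} {R : ℝ}
    (hR : 0 < R) (hB : closedBall c R ⊆ U) : IsSubharmonicOn (poissonExt v c R) U := by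
  have hc := continuousOn_poissonExt hR hU hB hv.1
  refine ⟨hc, fun x hx => ?_⟩
  by_cases hxb : x ∈ ball c R
  · exact (isSubharmonicOn_of_harmonic isOpen_ball (harmonicOnNhd_poissonExt hR hB hv.1)).2 x hxb
  · filter_upwards [hv.2 x hx, eventually_closedBall_subset_of_isOpen hU hx] with r h1 h3
    rw [poissonExt_of_notMem hxb]
    exact h1.trans (circleAverage_mono (circleIntegrable_of_closedBall_subset hv.1 h3.1 h3.2)
      (circleIntegrable_of_closedBall_subset hc h3.1 h3.2)
      fun z _ => hv.le_poissonExt hU hR hB z)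

/-- A pointwise bounded limit of functions reproducing the Poisson integral is harmonic. -/
lemma harmonicOnNhd_of_tendsto_poissonIntegral {c : ℂ} {R : ℝ} (hR : 0 < R) {a b : ℕ → ℂ → ℝ}
    {h : ℂ → ℝ} {M : ℝ} (ha : ∀ n, ContinuousOn (a n) (sphere c R))
    (haM : ∀ n, ∀ z ∈ sphere c R, |a n z| ≤ M)
    (hab : ∀ n, ∀ z ∈ ball c R, b n z = poissonIntegral (a n) c R z)
    (hah : ∀ z ∈ sphere c R, Tendsto (fun n => a n z) atTop (𝓝 (h z)))
    (hbh : ∀ z ∈ ball c R, Tendsto (fun n => b n z) atTop (𝓝 (h z))) :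
    HarmonicOnNhd h (ball c R) := by
  have hmem : ∀ θ, circleMap c R θ ∈ sphere c R := circleMap_mem_sphere c hR.le
  have hmeas : ∀ n, AEStronglyMeasurable (fun θ => a n (circleMap c R θ))
      (volume.restrict (uIoc 0 (2 * π))) := fun n =>
    ((ha n).comp_continuous (continuous_circleMap c R) hmem).aestronglyMeasurable
  have hhM : ∀ z ∈ sphere c R, |h z| ≤ M := fun z hz =>
    le_of_tendsto (hah z hz).abs (Eventually.of_forall fun n => haM n z hz)
  have hhm : AEStronglyMeasurable (fun θ => h (circleMap c R θ))
      (volume.restrict (uIoc 0 (2 * π))) :=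
    aestronglyMeasurable_of_tendsto_ae atTop hmeas
      (Eventually.of_forall fun θ => hah _ (hmem θ))
  have hhI : CircleIntegrable h c R := by
    rw [CircleIntegrable, intervalIntegrable_iff]
    have : IsFiniteMeasure (volume.restrict (uIoc 0 (2 * π))) :=
      isFiniteMeasure_restrict.2 (by simp [uIoc])
    exact Integrable.of_bound hhm M (Eventually.of_forall fun θ => hhM _ (hmem θ))
  intro z hz
  refine (harmonicAt_congr_nhds ?_).1 (harmonicAt_poissonIntegral hhI hz)
  filter_upwards [isOpen_ball.mem_nhds hz] with y hy
  refine tendsto_nhds_unique ?_ (hbh y hy)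
  have hk := circleIntegrable_poissonKernel_smul hhI hy
  simp_rw [hab _ y hy, poissonIntegral, circleAverage_def]
  apply Tendsto.const_smul
  have hkc : Continuous fun θ => poissonKernel c y (circleMap c R θ) :=
    (continuousOn_poissonKernel_sphere hy).comp_continuous (continuous_circleMap c R)
      (by rw [abs_of_pos hR]; exact hmem)
  refine intervalIntegral.tendsto_integral_filter_of_dominated_convergence
    (fun θ => poissonKernel c y (circleMap c R θ) * M) (Eventually.of_forall fun n => ?_)
    (Eventually.of_forall fun n => Eventually.of_forall fun θ _ => ?_) ?_
    (Eventually.of_forall fun θ _ => ?_)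
  · exact hkc.aestronglyMeasurable.mul (hmeas n)
  · rw [Pi.smul_apply', smul_eq_mul, norm_mul, Real.norm_eq_abs, Real.norm_eq_abs,
      abs_of_nonneg (poissonKernel_nonneg_of_mem hy (hmem θ))]
    exact mul_le_mul_of_nonneg_left (haM n _ (hmem θ)) (poissonKernel_nonneg_of_mem hy (hmem θ))
  · exact (hkc.mul continuous_const).intervalIntegrable _ _
  · exact (hah _ (hmem θ)).const_mul _

/-- **Poincaré's sweeping process**: a bounded subharmonic function has a harmonic majorant that
lies below every superharmonic majorant. -/
theorem IsSubharmonicOn.exists_harmonic_majorant (hU : IsOpen U) (hv : IsSubharmonicOn v U) {M : ℝ}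
    (hM : ∀ z ∈ U, v z ≤ M) :
    ∃ h : ℂ → ℝ, HarmonicOnNhd h U ∧ (∀ z ∈ U, v z ≤ h z) ∧
      ∀ w : ℂ → ℝ, IsSubharmonicOn (fun z => - w z) U → (∀ z ∈ U, v z ≤ w z) →
        ∀ z ∈ U, h z ≤ w z := by
  rcases U.eq_empty_or_nonempty with rfl | hne
  · exact ⟨0, fun x hx => hx.elim, by simp, by simp⟩
  have hrad : ∀ x, ∃ r : ℝ, x ∈ U → 0 < r ∧ closedBall x r ⊆ U := by
    intro x
    by_cases hx : x ∈ U
    · obtain ⟨r, hr⟩ := (eventually_closedBall_subset_of_isOpen hU hx).exists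
      exact ⟨r, fun _ => hr⟩
    · exact ⟨0, fun h => (hx h).elim⟩
  choose R hR using hrad
  obtain ⟨t, htU, htc, htcov⟩ := TopologicalSpace.countable_cover_nhdsWithin
    (f := fun x => ball x (R x)) (s := U)
    fun x hx => mem_nhdsWithin_of_mem_nhds (ball_mem_nhds x (hR x hx).1)
  have htne : t.Nonempty := by
    obtain ⟨x, hx⟩ := hne
    obtain ⟨y, hy, -⟩ := mem_iUnion₂.1 (htcov hx)
    exact ⟨y, hy⟩
  obtain ⟨c, rfl⟩ := htc.exists_eq_range htne
  have hcU : ∀ k, c k ∈ U := fun k => htU (mem_range_self k)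
  -- Step `n` sweeps the disc numbered `n.unpair.1`, so every disc of the countable cover is swept
  -- infinitely often.
  let s : ℕ → ℂ → ℝ := fun n => Nat.rec v
    (fun n f => _root_.poissonExt f (c n.unpair.1) (R (c n.unpair.1))) n
  have hs0 : s 0 = v := rfl
  have hss : ∀ n, s (n + 1) = _root_.poissonExt (s n) (c n.unpair.1) (R (c n.unpair.1)) :=
    fun n => rfl
  have hsub : ∀ n, IsSubharmonicOn (s n) U := by
    intro n
    induction n with
    | zero => exact hv
    | succ n ih => rw [hss]; exact ih.poissonExt hU (hR _ (hcU _)).1 (hR _ (hcU _)).2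
  have hmono : ∀ z, Monotone fun n => s n z := fun z => monotone_nat_of_le_succ fun n => by
    rw [hss]; exact (hsub n).le_poissonExt hU (hR _ (hcU _)).1 (hR _ (hcU _)).2 z
  have hup : ∀ w : ℂ → ℝ, IsSubharmonicOn (fun z => - w z) U → (∀ z ∈ U, v z ≤ w z) →
      ∀ n, ∀ z ∈ U, s n z ≤ w z := by
    intro w hw hvw n
    induction n with
    | zero => exact hvw
    | succ n ih =>
      rw [hss]
      exact poissonExt_le_of_superharmonic (hsub n).1 hU (hR _ (hcU _)).1 (hR _ (hcU _)).2 hw ih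
  have hsM := hup (fun _ => M) (isSubharmonicOn_const hU (-M)) hM
  set h : ℂ → ℝ := fun z => ⨆ n, s n z
  have hbdd : ∀ z ∈ U, BddAbove (range fun n => s n z) := fun z hz =>
    ⟨M, by rintro _ ⟨n, rfl⟩; exact hsM n z hz⟩
  have hlim : ∀ z ∈ U, Tendsto (fun n => s n z) atTop (𝓝 (h z)) := fun z hz =>
    tendsto_atTop_ciSup (hmono z) (hbdd z hz)
  refine ⟨h, fun z hz => ?_, fun z hz => le_ciSup (hbdd z hz) 0,
    fun w hw hvw z hz => ciSup_le fun n => hup w hw hvw n z hz⟩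
  obtain ⟨y, ⟨k, rfl⟩, hk⟩ := mem_iUnion₂.1 (htcov hz)
  obtain ⟨hR0, hRU⟩ := hR _ (hcU k)
  have hSU : sphere (c k) (R (c k)) ⊆ U := sphere_subset_closedBall.trans hRU
  obtain ⟨M', hM'⟩ := (isCompact_sphere (c k) (R (c k))).exists_bound_of_continuousOn
    (hv.1.mono hSU)
  -- Along `n = Nat.pair k j` disc `k` is the one being swept: inside it `s (n + 1)` is the Poisson
  -- integral of `s n`. Both subsequences converge to `h`, which is therefore its own Poisson
  -- integral there.
  have hpair : Tendsto (fun j => Nat.pair k j) atTop atTop :=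
    tendsto_atTop_mono (fun j => Nat.right_le_pair k j) tendsto_id
  refine harmonicOnNhd_of_tendsto_poissonIntegral hR0 (a := fun j => s (Nat.pair k j))
    (b := fun j => s (Nat.pair k j + 1)) (M := max M M') (fun n => (hsub _).1.mono hSU)
    (fun n x hx => ?_) (fun n x hx => ?_) (fun x hx => (hlim x (hSU hx)).comp hpair)
    (fun x hx => (hlim x (hRU (ball_subset_closedBall hx))).comp
      ((tendsto_add_atTop_nat 1).comp hpair)) z hk
  · have h1 := hsM (Nat.pair k n) x (hSU hx)
    have h2 := hmono x (Nat.zero_le (Nat.pair k n))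
    have h3 := (abs_le.1 (hM' x hx)).1
    rw [abs_le]
    constructor
    · have := le_max_right M M'
      simp only [hs0] at h2
      linarith
    · exact h1.trans (le_max_left _ _)
  · rw [hss, Nat.unpair_pair, poissonExt_of_mem hx]

end Subharmonic

/-! ### Barriers at boundary points lying on a regular curve. -/

section Barrier

open Metric Filter Topology Real InnerProductSpace

/-- A barrier for `U` at the point `p`. -/
structure IsBarrierAt (β : ℂ → ℝ) (U : Set ℂ) (p : ℂ) : Prop where
  superharmonic : IsSubharmonicOn (fun z => - β z) U
  nonneg : ∀ z ∈ U, 0 ≤ β z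
  tendsto : Tendsto β (𝓝[U] p) (𝓝 0)
  pos_away : ∀ ρ > 0, ∃ c > 0, ∀ z ∈ U, ρ ≤ dist z p → c ≤ β z

/-- The real part of the principal square root. -/
noncomputable def reSqrt (η : ℂ) : ℝ := (Complex.exp (Complex.log η / 2)).re

lemma harmonicAt_reSqrt_comp {f : ℂ → ℂ} {z : ℂ} (hf : AnalyticAt ℂ f z)
    (hz : f z ∈ Complex.slitPlane) : HarmonicAt (fun z => reSqrt (f z)) z := by
  apply AnalyticAt.harmonicAt_re (f := fun z => Complex.exp (Complex.log (f z) / 2))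
  have := hf.clog hz
  fun_prop

/-- The hypothesis says `|arg η| < 3π/4`, so the root has argument below `3π/8`, whose cosine
exceeds `1/4`. Algebraically, `r² = η` gives `(Re r)² = (‖η‖ + Re η)/2`, and `Re η ≥ -(3/4)‖η‖`. -/
lemma reSqrt_bounds {η : ℂ} (h : -|η.im| < η.re) :
    η ∈ Complex.slitPlane ∧ reSqrt η ≤ √‖η‖ ∧ √‖η‖ / 4 ≤ reSqrt η := by
  have hs : η ∈ Complex.slitPlane := by
    rw [Complex.mem_slitPlane_iff]
    by_contra! hc
    rw [hc.2] at h; simp at h; linarith [hc.1]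
  have hη : η ≠ 0 := Complex.slitPlane_ne_zero hs
  set r := Complex.exp (Complex.log η / 2) with hr
  have hr2 : r ^ 2 = η := by
    rw [hr, ← Complex.exp_nat_mul]
    rw [show ((2 : ℕ) : ℂ) * (Complex.log η / 2) = Complex.log η by push_cast; ring,
      Complex.exp_log hη]
  have hn : ‖r‖ ^ 2 = ‖η‖ := by rw [← norm_pow, hr2]
  have hn' : √‖η‖ = ‖r‖ := by rw [← hn, Real.sqrt_sq (norm_nonneg _)]
  have hpos : 0 ≤ r.re := by
    rw [hr, Complex.exp_re]
    refine mul_nonneg (Real.exp_pos _).le (Real.cos_nonneg_of_mem_Icc ?_)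
    have h1 := Complex.neg_pi_lt_arg η
    have h2 := Complex.arg_le_pi η
    have h3 : (Complex.log η / 2).im = Complex.arg η / 2 := by
      rw [show (2 : ℂ) = ((2 : ℝ) : ℂ) by norm_num, Complex.div_ofReal_im, Complex.log_im]
    rw [h3]; constructor <;> linarith
  refine ⟨hs, ?_, ?_⟩
  · rw [hn']; exact Complex.re_le_norm r
  · rw [hn']
    show ‖r‖ / 4 ≤ r.re
    have e1 : ‖r‖ ^ 2 = r.re ^ 2 + r.im ^ 2 := by
      rw [← Complex.normSq_eq_norm_sq, Complex.normSq_apply]; ring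
    have e2 : η.re = r.re ^ 2 - r.im ^ 2 := by rw [← hr2, sq, Complex.mul_re]; ring
    have e3 : ‖η‖ ^ 2 = η.re ^ 2 + η.im ^ 2 := by
      rw [← Complex.normSq_eq_norm_sq, Complex.normSq_apply]; ring
    have h4 : -(3 / 4 * ‖η‖) ≤ η.re := by
      by_contra! hc
      have h0 := norm_nonneg η
      have h5 : (3 / 4 * ‖η‖) ^ 2 < η.re ^ 2 := by nlinarith
      have h6 : η.re ^ 2 ≤ η.im ^ 2 := by rw [← sq_abs η.im]; nlinarith
      nlinarith
    have h7 : (‖r‖ / 4) ^ 2 ≤ r.re ^ 2 := by rw [← hn] at h4; nlinarith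
    exact (sq_le_sq₀ (by positivity) hpos).1 h7

/-- A curve with nonzero strict derivative is locally a Lipschitz graph over its tangent. -/
lemma exists_lipschitz_graph {σ : ℝ → ℂ} {t₀ : ℝ} (hσ : HasStrictDerivAt σ 1 t₀) (h0 : σ t₀ = 0) :
    ∃ ρ > 0, ∃ g : ℝ → ℝ, (∀ x y, |x| < ρ → |y| < ρ → |g x - g y| ≤ |x - y|) ∧ g 0 = 0 ∧
      ∀ x, |x| < ρ → ∃ t, σ t = x + g x * Complex.I := by
  -- With error `1/4`, real parts move by at least `3/4 |s - t|` and imaginary parts by at most `1/4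
  -- |s - t|`, so the graph has slope at most `1`.
  have h1 := hσ.hasStrictFDerivAt.isLittleO.def (c := 1 / 4) (by norm_num)
  obtain ⟨ε, hε, hball⟩ := Metric.eventually_nhds_iff_ball.1 h1
  set δ := ε / 2
  have hδ : 0 < δ := half_pos hε
  have key : ∀ s t, |s - t₀| ≤ δ → |t - t₀| ≤ δ →
      |(σ s).re - (σ t).re - (s - t)| ≤ 1 / 4 * |s - t| ∧
      |(σ s).im - (σ t).im| ≤ 1 / 4 * |s - t| := by
    intro s t hs ht
    have hmem : (s, t) ∈ ball (t₀, t₀) ε := by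
      rw [mem_ball, Prod.dist_eq, max_lt_iff, Real.dist_eq, Real.dist_eq]
      exact ⟨hs.trans_lt (half_lt_self hε), ht.trans_lt (half_lt_self hε)⟩
    have h := hball (s, t) hmem
    simp only [Real.norm_eq_abs] at h
    have hre := (Complex.abs_re_le_norm _).trans h
    have him := (Complex.abs_im_le_norm _).trans h
    simp at hre him
    norm_num at hre him ⊢
    exact ⟨hre, him⟩
  have hcont : ContinuousOn (fun t => (σ t).re) (Icc (t₀ - δ) (t₀ + δ)) := by
    refine LipschitzOnWith.continuousOn (K := 2) (LipschitzOnWith.of_dist_le_mul fun s hs t ht => ?_)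
    have h2 := (key s t (abs_le.2 ⟨by linarith [hs.1], by linarith [hs.2]⟩)
      (abs_le.2 ⟨by linarith [ht.1], by linarith [ht.2]⟩)).1
    rw [Real.dist_eq, Real.dist_eq]
    have h3 : |(σ s).re - (σ t).re| ≤ |(σ s).re - (σ t).re - (s - t)| + |s - t| := by
      simpa using abs_add_le ((σ s).re - (σ t).re - (s - t)) (s - t)
    have := abs_nonneg (s - t)
    norm_num; linarith
  -- At `t₀ ± δ` the real part has passed `±(3/4)δ`, so the intermediate value theorem reaches every
  -- abscissa in between.
  have hex : ∀ x, ∃ t, |x| < 3 / 4 * δ → |t - t₀| ≤ δ ∧ (σ t).re = x := by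
    intro x
    by_cases hx : |x| < 3 / 4 * δ
    swap
    · exact ⟨0, fun h => (hx h).elim⟩
    have h00 : |t₀ - t₀| ≤ δ := by simpa using hδ.le
    have ha := (key (t₀ - δ) t₀ (by simp [abs_of_pos hδ]) h00).1
    have hb := (key (t₀ + δ) t₀ (by simp [abs_of_pos hδ]) h00).1
    rw [h0] at ha hb
    simp [abs_of_pos hδ] at ha hb
    have ha := (abs_le.1 ha).2
    have hb := (abs_le.1 hb).1
    obtain ⟨hx1, hx2⟩ := abs_lt.1 hx
    obtain ⟨t, ht, htx⟩ := intermediate_value_Icc (by linarith) hcont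
      (show x ∈ Icc _ _ from ⟨by linarith, by linarith⟩)
    exact ⟨t, fun _ => ⟨abs_le.2 ⟨by linarith [ht.1], by linarith [ht.2]⟩, htx⟩⟩
  choose τ hτ using hex
  have hlip : ∀ s t, |s - t₀| ≤ δ → |t - t₀| ≤ δ →
      |(σ s).im - (σ t).im| ≤ |(σ s).re - (σ t).re| := by
    intro s t hs ht
    obtain ⟨k1, k2⟩ := key s t hs ht
    have h3 : |s - t| ≤ |(σ s).re - (σ t).re - (s - t)| + |(σ s).re - (σ t).re| := by
      have := abs_sub ((σ s).re - (σ t).re) ((σ s).re - (σ t).re - (s - t))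
      rw [sub_sub_cancel] at this
      linarith
    have := abs_nonneg (s - t)
    linarith
  refine ⟨3 / 4 * δ, by positivity, fun x => (σ (τ x)).im, fun x y hx hy => ?_, ?_, fun x hx => ?_⟩
  · have := hlip _ _ (hτ x hx).1 (hτ y hy).1
    rwa [(hτ x hx).2, (hτ y hy).2] at this
  · have hz := hτ 0 (by simpa using hδ)
    have := hlip (τ 0) t₀ hz.1 (by simpa using hδ.le)
    rw [hz.2, h0] at this
    simpa using this
  · refine ⟨τ x, Complex.ext ?_ ?_⟩
    · simp [(hτ x hx).2]
    · simp

/-- Existence of a barrier at a boundary point on a regular curve in the complement. -/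
theorem exists_barrier {U : Set ℂ} {γ : ℝ → ℂ} {t₀ : ℝ} {d : ℂ} (hU : IsOpen U)
    (hγ : HasStrictDerivAt γ d t₀) (hd : d ≠ 0) (hγU : ∀ t, γ t ∉ U) :
    ∃ β, IsBarrierAt β U (γ t₀) := by
  set p := γ t₀ with hp
  -- The affine change `ζ = (z - p) / d` puts the point at `0` with tangent along the real axis.
  have hσ : HasStrictDerivAt (fun t => (γ t - p) / d) 1 t₀ := by
    have := HasStrictDerivAt.mul_const (show HasStrictDerivAt (fun t => γ t - p) d t₀ from
      HasDerivAtFilter.sub_const p hγ) d⁻¹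
    rwa [mul_inv_cancel₀ hd] at this
  obtain ⟨ρ, hρ, g, hg, hg0, hgr⟩ := exists_lipschitz_graph hσ (by simp [hp])
  set ζ : ℂ → ℂ := fun z => (z - p) / d with hζ
  have hζan : ∀ z, AnalyticAt ℂ ζ z := fun z => by
    simp only [hζ]; fun_prop (disch := exact hd)
  have hζn : ∀ z, ‖ζ z‖ = ‖z - p‖ / ‖d‖ := fun z => norm_div _ _
  have hζc : Continuous ζ := by simp only [hζ]; fun_prop
  set V : Set ℂ := {z | z ∈ U ∧ ‖ζ z‖ < ρ}
  have hV : IsOpen V := hU.inter (isOpen_lt hζc.norm continuous_const)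
  have hre : ∀ z ∈ V, |(ζ z).re| < ρ := fun z hz => (Complex.abs_re_le_norm _).trans_lt hz.2
  have hgc : ∀ z ∈ V, ContinuousAt (fun z => (ζ z).im - g (ζ z).re) z := by
    intro z hz
    have hgx : ContinuousAt g (ζ z).re := by
      have hI : {x : ℝ | |x| < ρ} ∈ 𝓝 (ζ z).re :=
        (isOpen_lt continuous_abs continuous_const).mem_nhds (hre z hz)
      refine ContinuousOn.continuousAt (LipschitzOnWith.continuousOn (K := 1)
        (LipschitzOnWith.of_dist_le_mul fun x hx y hy => ?_)) hI
      simpa [Real.dist_eq] using hg x y hx hy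
    have h1 : ContinuousAt (fun z => (ζ z).re) z := (Complex.continuous_re.comp hζc).continuousAt
    have h2 : ContinuousAt (fun z => (ζ z).im) z := (Complex.continuous_im.comp hζc).continuousAt
    exact h2.sub (ContinuousAt.comp' (f := fun z => (ζ z).re) hgx h1)
  have hgne : ∀ z ∈ V, (ζ z).im - g (ζ z).re ≠ 0 := by
    intro z hz h
    obtain ⟨t, ht⟩ := hgr _ (hre z hz)
    have : (γ t - p) / d = (z - p) / d := by
      rw [ht]
      apply Complex.ext
      · simp [hζ]
      · simp; linarith
    rw [div_left_inj' hd, sub_left_inj] at this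
    exact hγU t (this ▸ hz.1)
  have hgabs : ∀ z ∈ V, |g (ζ z).re| ≤ |(ζ z).re| := by
    intro z hz
    simpa [hg0] using hg _ 0 (hre z hz) (by simpa using hρ)
  -- `V` avoids the graph of `g`, so it splits into open pieces above and below it. As `|g x| ≤
  -- |x|`, rotating `ζ` by `-i` above and by `i` below puts it in the sector of `reSqrt_bounds`.
  -- Thus `w` is harmonic on both pieces and comparable with `√‖ζ‖`.
  set w : ℂ → ℝ := fun z => open Classical in
    if 0 < (ζ z).im - g (ζ z).re then reSqrt (-Complex.I * ζ z) else reSqrt (Complex.I * ζ z)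
  have hw : ∀ z ∈ V, HarmonicAt w z ∧ w z ≤ √‖ζ z‖ ∧ √‖ζ z‖ / 4 ≤ w z := by
    intro z hz
    rcases lt_or_gt_of_ne (hgne z hz) with hlt | hgt
    · have hcone : -|(Complex.I * ζ z).im| < (Complex.I * ζ z).re := by
        have := abs_le.1 (hgabs z hz)
        simp; linarith
      obtain ⟨b1, b2, b3⟩ := reSqrt_bounds hcone
      have hwz : w z = reSqrt (Complex.I * ζ z) := if_neg hlt.not_gt
      rw [norm_mul, Complex.norm_I, one_mul] at b2 b3
      refine ⟨?_, hwz ▸ b2, hwz ▸ b3⟩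
      refine (harmonicAt_congr_nhds ?_).1
        (harmonicAt_reSqrt_comp (analyticAt_const.mul (hζan z)) b1)
      filter_upwards [(hgc z hz).eventually_lt_const hlt] with y hy
      exact (if_neg hy.not_gt).symm
    · have hcone : -|(-Complex.I * ζ z).im| < (-Complex.I * ζ z).re := by
        have := abs_le.1 (hgabs z hz)
        simp; linarith
      obtain ⟨b1, b2, b3⟩ := reSqrt_bounds hcone
      have hwz : w z = reSqrt (-Complex.I * ζ z) := if_pos hgt
      rw [norm_mul, norm_neg, Complex.norm_I, one_mul] at b2 b3
      refine ⟨?_, hwz ▸ b2, hwz ▸ b3⟩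
      refine (harmonicAt_congr_nhds ?_).1
        (harmonicAt_reSqrt_comp (analyticAt_const.mul (hζan z)) b1)
      filter_upwards [(hgc z hz).eventually_const_lt hgt] with y hy
      exact (if_pos hy).symm
  -- A lower bound of `w` where `‖ζ‖ ≥ ρ/2`: there `min w m` is already the constant `m`, and
  -- extends by it to all of `U`.
  set m : ℝ := √(ρ / 2) / 4
  have hm : 0 < m := by positivity
  set β : ℂ → ℝ := fun z => open Classical in if ‖ζ z‖ < ρ then min (w z) m else m with hβ
  have hβ1 : ∀ z, ‖ζ z‖ < ρ → β z = min (w z) m := fun z hz => if_pos hz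
  have hβ2 : ∀ z ∈ U, ρ / 2 < ‖ζ z‖ → β z = m := by
    intro z hz h
    by_cases hlt : ‖ζ z‖ < ρ
    · rw [hβ1 z hlt, min_eq_right]
      refine le_trans ?_ (hw z ⟨hz, hlt⟩).2.2
      exact div_le_div_of_nonneg_right (Real.sqrt_le_sqrt h.le) (by norm_num)
    · exact if_neg hlt
  refine ⟨β, ⟨IsSubharmonicOn.of_eqOn_nhds fun z hz => ?_, fun z hz => ?_, ?_, fun r hr => ?_⟩⟩
  · by_cases hlt : ‖ζ z‖ < ρ
    · refine ⟨V, hV.mem_nhds ⟨hz, hlt⟩, fun z => max (-w z) (-m),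
        (isSubharmonicOn_neg_of_harmonic hV fun y hy => (hw y hy).1).sup hV
          (isSubharmonicOn_const hV _), fun y hy => ?_⟩
      show - β y = _
      rw [hβ1 y hy.2]
      exact (max_neg_neg _ _).symm
    · have ho : IsOpen {y | y ∈ U ∧ ρ / 2 < ‖ζ y‖} :=
        hU.inter (isOpen_lt continuous_const hζc.norm)
      refine ⟨_, ho.mem_nhds ⟨hz, by linarith⟩, fun _ => -m, isSubharmonicOn_const ho _,
        fun y hy => ?_⟩
      show - β y = _
      rw [hβ2 y hy.1 hy.2]
  · by_cases hlt : ‖ζ z‖ < ρ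
    · rw [hβ1 z hlt]
      exact le_min ((by positivity : (0 : ℝ) ≤ √‖ζ z‖ / 4).trans (hw z ⟨hz, hlt⟩).2.2) hm.le
    · rw [hβ]; simp [hlt, hm.le]
  · have hlim : Tendsto (fun z => √‖ζ z‖) (𝓝[U] p) (𝓝 0) := by
      have : Tendsto (fun z => √‖ζ z‖) (𝓝 p) (𝓝 (√‖ζ p‖)) :=
        (hζc.norm.sqrt).tendsto p
      simp only [hζ, sub_self, zero_div, norm_zero, Real.sqrt_zero] at this
      exact this.mono_left nhdsWithin_le_nhds
    have hev : ∀ᶠ z in 𝓝[U] p, z ∈ V := by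
      have : ∀ᶠ z in 𝓝 p, ‖ζ z‖ < ρ :=
        hζc.norm.continuousAt.eventually_lt_const (by simpa [hζ] using hρ)
      filter_upwards [self_mem_nhdsWithin, this.filter_mono nhdsWithin_le_nhds] with z h1 h2
      exact ⟨h1, h2⟩
    refine tendsto_of_tendsto_of_tendsto_of_le_of_le' tendsto_const_nhds hlim ?_ ?_
    · filter_upwards [hev] with z hz
      rw [hβ1 z hz.2]
      exact le_min ((by positivity : (0 : ℝ) ≤ √‖ζ z‖ / 4).trans (hw z hz).2.2) hm.le
    · filter_upwards [hev] with z hz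
      rw [hβ1 z hz.2]
      exact (min_le_left _ _).trans (hw z hz).2.1
  · refine ⟨min (√(r / ‖d‖) / 4) m, by positivity, fun z hz hrz => ?_⟩
    rw [dist_eq_norm] at hrz
    by_cases hlt : ‖ζ z‖ < ρ
    · rw [hβ1 z hlt]
      refine min_le_min_right _ (le_trans ?_ (hw z ⟨hz, hlt⟩).2.2)
      rw [hζn]
      gcongr
    · rw [hβ]; simp [hlt]

end Barrier

/-! ### The Dirichlet problem in the complex plane. -/

section DirichletComplex

open Metric Filter Topology Real InnerProductSpace

variable {U : Set ℂ}

lemma le_of_harmonic_of_frontier (hU : IsOpen U) (hb : Bornology.IsBounded U) {h : ℂ → ℝ}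
    (hh : HarmonicOnNhd h U) (hc : ContinuousOn h (closure U)) {M : ℝ}
    (hM : ∀ z ∈ frontier U, h z ≤ M) : ∀ z ∈ closure U, h z ≤ M :=
  (isSubharmonicOn_of_harmonic hU hh).le_of_frontier hU hb hc hM

lemma abs_sub_le_of_harmonic_of_frontier (hU : IsOpen U) (hb : Bornology.IsBounded U)
    {h k : ℂ → ℝ} (hh : HarmonicOnNhd h U) (hc : ContinuousOn h (closure U))
    (kh : HarmonicOnNhd k U) (kc : ContinuousOn k (closure U)) {M : ℝ}
    (hM : ∀ z ∈ frontier U, |h z - k z| ≤ M) : ∀ z ∈ closure U, |h z - k z| ≤ M := by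
  intro z hz
  have h1 := le_of_harmonic_of_frontier hU hb (hh.sub kh) (hc.sub kc)
    (fun x hx => (abs_le.1 (hM x hx)).2) z hz
  have h2 := le_of_harmonic_of_frontier hU hb (kh.sub hh) (kc.sub hc) (M := M)
    (fun x hx => by have := (abs_le.1 (hM x hx)).1; simp only [Pi.sub_apply]; linarith) z hz
  simp only [Pi.sub_apply] at h1 h2
  rw [abs_le]; constructor <;> linarith

/-- The Dirichlet problem for subharmonic boundary data. -/
theorem IsSubharmonicOn.exists_dirichlet (hU : IsOpen U) (hb : Bornology.IsBounded U)
    (hreg : ∀ p ∈ frontier U, ∃ β, IsBarrierAt β U p) {g : ℂ → ℝ}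
    (hg : IsSubharmonicOn g U) (hgc : ContinuousOn g (closure U)) :
    ∃ h : ℂ → ℝ, HarmonicOnNhd h U ∧ ContinuousOn h (closure U) ∧ EqOn h g (frontier U) := by
  obtain ⟨M, hM⟩ := hb.isCompact_closure.exists_bound_of_continuousOn hgc
  obtain ⟨h, hh, hgh, hhw⟩ := hg.exists_harmonic_majorant hU
    fun z hz => (abs_le.1 (hM z (subset_closure hz))).2
  classical
  set k : ℂ → ℝ := fun z => if z ∈ U then h z else g z
  have hkU : ∀ z ∈ U, k z = h z := fun z hz => if_pos hz
  have hkF : ∀ z ∉ U, k z = g z := fun z hz => if_neg hz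
  have hkh : HarmonicOnNhd k U := fun z hz =>
    (harmonicAt_congr_nhds (Filter.eventuallyEq_of_mem (hU.mem_nhds hz) hkU)).2 (hh z hz)
  have hfr : ∀ z ∈ frontier U, z ∉ U := fun z hz => by
    rw [hU.frontier_eq] at hz; exact hz.2
  refine ⟨k, hkh, ?_, fun z hz => hkF z (hfr z hz)⟩
  intro p hp
  by_cases hpU : p ∈ U
  · exact (hkh p hpU).1.continuousAt.continuousWithinAt
  have hpF : p ∈ frontier U := by rw [hU.frontier_eq]; exact ⟨hp, hpU⟩
  rw [ContinuousWithinAt, hkF p hpU, closure_eq_self_union_frontier, nhdsWithin_union, tendsto_sup]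
  constructor
  swap
  · refine ((hgc p hp).mono_left (nhdsWithin_mono _ frontier_subset_closure)).congr' ?_
    filter_upwards [self_mem_nhdsWithin] with z hz
    exact (hkF z (hfr z hz)).symm
  obtain ⟨β, hβ⟩ := hreg p hpF
  rw [Metric.tendsto_nhds]
  intro ε hε
  obtain ⟨ρ, hρ, hρg⟩ := Metric.continuousOn_iff.1 hgc p hp (ε / 2) (half_pos hε)
  obtain ⟨c, hc, hcβ⟩ := hβ.pos_away ρ hρ
  have hM0 : 0 ≤ M := (norm_nonneg _).trans (hM p hp)
  set K : ℝ := 2 * M / c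
  have hK : 0 ≤ K := by positivity
  -- This superharmonic function majorizes `g`, hence also `h`, and tends to `g p + ε/2` at `p`. The
  -- bound from below is simply `g ≤ h`, which is why subharmonic data are treated first.
  have hsup : IsSubharmonicOn (fun z => -((g p + ε / 2) + K * β z)) U := by
    have h1 := (isSubharmonicOn_const hU (-(g p + ε / 2))).add hU
      (hβ.superharmonic.const_mul hK)
    have h2 : (fun z => -((g p + ε / 2) + K * β z)) =
        fun z => -(g p + ε / 2) + K * -β z := by ext z; ring
    rw [h2]; exact h1
  have hle : ∀ z ∈ U, g z ≤ (g p + ε / 2) + K * β z := by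
    intro z hz
    by_cases hd : dist z p < ρ
    · have h1 := hρg z (subset_closure hz) hd
      rw [Real.dist_eq] at h1
      have := mul_nonneg hK (hβ.nonneg z hz)
      linarith [(abs_lt.1 h1).2]
    · have h1 := hcβ z hz (not_lt.1 hd)
      have h2 : 2 * M ≤ K * β z := by
        calc 2 * M = K * c := by simp only [K]; field_simp
          _ ≤ _ := by gcongr
      have h3 := (abs_le.1 (hM z (subset_closure hz))).2
      have h4 := (abs_le.1 (hM p hp)).1
      linarith
  have hhle := hhw _ hsup hle
  have hlim : Tendsto (fun z => K * β z) (𝓝[U] p) (𝓝 0) := by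
    simpa using hβ.tendsto.const_mul K
  have hgl : Tendsto g (𝓝[U] p) (𝓝 (g p)) :=
    (hgc p hp).mono_left (nhdsWithin_mono _ subset_closure)
  filter_upwards [self_mem_nhdsWithin, hlim.eventually_lt_const (half_pos hε),
    Metric.tendsto_nhds.1 hgl ε hε] with z hz h1 h2
  rw [hkU z hz, Real.dist_eq, abs_lt]
  rw [Real.dist_eq, abs_lt] at h2
  have := hgh z hz
  have := hhle z hz
  constructor <;> linarith

/-- By the maximum principle, uniform convergence of the boundary data makes the solutions uniformly
Cauchy on the closure; the limit inherits the Poisson reproduction on discs. -/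
lemma exists_dirichlet_of_tendsto (hU : IsOpen U) (hb : Bornology.IsBounded U)
    {h : ℕ → ℂ → ℝ} {g : ℕ → C(frontier U, ℝ)} {g' : C(frontier U, ℝ)}
    (hh : ∀ n, HarmonicOnNhd (h n) U) (hc : ∀ n, ContinuousOn (h n) (closure U))
    (hg : ∀ n, ∀ x : frontier U, h n x = g n x) (hlim : Tendsto g atTop (𝓝 g')) :
    ∃ k : ℂ → ℝ, HarmonicOnNhd k U ∧ ContinuousOn k (closure U) ∧
      ∀ x : frontier U, k x = g' x := by
  have : CompactSpace (frontier U) :=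
    isCompact_iff_compactSpace.1 (hb.isCompact_closure.of_isClosed_subset isClosed_frontier
      frontier_subset_closure)
  have hdist : ∀ m n, ∀ z ∈ closure U, dist (h m z) (h n z) ≤ dist (g m) (g n) := by
    intro m n
    refine abs_sub_le_of_harmonic_of_frontier hU hb (hh m) (hc m) (hh n) (hc n) fun z hz => ?_
    rw [hg m ⟨z, hz⟩, hg n ⟨z, hz⟩]
    exact ContinuousMap.dist_apply_le_dist (f := g m) (g := g n) ⟨z, hz⟩
  have hcs := hlim.cauchySeq
  have hucs : UniformCauchySeqOn h atTop (closure U) := by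
    rw [Metric.uniformCauchySeqOn_iff]
    intro ε hε
    obtain ⟨N, hN⟩ := Metric.cauchySeq_iff.1 hcs ε hε
    exact ⟨N, fun m hm n hn z hz => (hdist m n z hz).trans_lt (hN m hm n hn)⟩
  have hex : ∀ z, ∃ l, z ∈ closure U → Tendsto (fun n => h n z) atTop (𝓝 l) := by
    intro z
    by_cases hz : z ∈ closure U
    · obtain ⟨l, hl⟩ := cauchySeq_tendsto_of_complete (hucs.cauchySeq hz)
      exact ⟨l, fun _ => hl⟩
    · exact ⟨0, fun h => (hz h).elim⟩
  choose k hk using hex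
  have hunif := hucs.tendstoUniformlyOn_of_tendsto fun z hz => hk z hz
  refine ⟨k, fun z hz => ?_, hunif.continuousOn (Frequently.of_forall hc), fun x => ?_⟩
  · obtain ⟨r, hr, hrU⟩ := (eventually_closedBall_subset_of_isOpen hU hz).exists
    obtain ⟨M, hM⟩ := (Metric.isBounded_range_of_tendsto g hlim).exists_norm_le
    have hbd : ∀ n, ∀ x ∈ closure U, |h n x| ≤ M := by
      intro n x hx
      have := abs_sub_le_of_harmonic_of_frontier hU hb (hh n) (hc n) (k := fun _ => 0)
        (harmonicOnNhd_const 0) continuousOn_const (M := M) (fun y hy => by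
          rw [sub_zero, hg n ⟨y, hy⟩]
          exact ((g n).norm_coe_le_norm ⟨y, hy⟩).trans (hM _ (mem_range_self n))) x hx
      simpa using this
    refine harmonicOnNhd_of_tendsto_poissonIntegral hr (a := h) (b := h) (M := M)
      (fun n => (hc n).mono ((sphere_subset_closedBall.trans hrU).trans subset_closure))
      (fun n x hx => hbd n x (subset_closure (hrU (sphere_subset_closedBall hx))))
      (fun n x hx => (poissonIntegral_eq_of_harmonic ?_ hx).symm)
      (fun x hx => hk x (subset_closure (hrU (sphere_subset_closedBall hx))))
      (fun x hx => hk x (subset_closure (hrU (ball_subset_closedBall hx)))) z (mem_ball_self hr)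
    refine ⟨(hh n).mono (ball_subset_closedBall.trans hrU), (hc n).mono ?_⟩
    exact closure_mono (ball_subset_closedBall.trans hrU)
  · refine tendsto_nhds_unique (hk x (frontier_subset_closure x.2)) ?_
    simp_rw [hg]
    exact ((continuous_eval_const x).tendsto g').comp hlim

/-- **Solvability of the Dirichlet problem** on a bounded open set with barriers. -/
theorem exists_dirichlet_complex (hU : IsOpen U) (hb : Bornology.IsBounded U)
    (hreg : ∀ p ∈ frontier U, ∃ β, IsBarrierAt β U p) (g : C(frontier U, ℝ)) :
    ∃ h : ℂ → ℝ, HarmonicOnNhd h U ∧ ContinuousOn h (closure U) ∧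
      ∀ x : frontier U, h x = g x := by
  have : CompactSpace (frontier U) :=
    isCompact_iff_compactSpace.1 (hb.isCompact_closure.of_isClosed_subset isClosed_frontier
      frontier_subset_closure)
  -- Differences of subharmonic functions form a lattice, since `max (a - b) (c - d) = max (a + d)
  -- (c + b) - (b + d)`; the lattice form of Stone–Weierstrass then gives density of their traces.
  set L : Set C(frontier U, ℝ) := {g | ∃ a b : ℂ → ℝ, (IsSubharmonicOn a U ∧
    ContinuousOn a (closure U)) ∧ (IsSubharmonicOn b U ∧ ContinuousOn b (closure U)) ∧
    ∀ x : frontier U, g x = a x - b x} with hL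
  have hharm : ∀ (f : ℂ → ℂ) (gf : C(frontier U, ℝ)), (∀ z, AnalyticAt ℂ f z) →
      (∀ x : frontier U, gf x = (f x).re) → gf ∈ L := by
    intro f gf hf hgf
    refine ⟨fun z => (f z).re, fun _ => 0,
      ⟨isSubharmonicOn_of_harmonic hU fun z _ => (hf z).harmonicAt_re, ?_⟩,
      ⟨isSubharmonicOn_const hU 0, continuousOn_const⟩, by simpa using hgf⟩
    exact fun z _ => (Complex.continuous_re.continuousAt.comp
      (hf z).continuousAt).continuousWithinAt
  have hsup : ∀ f ∈ L, ∀ g ∈ L, f ⊔ g ∈ L := by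
    rintro f ⟨a, b, ⟨ha, ha'⟩, ⟨hb, hb'⟩, hf⟩ g ⟨c, d, ⟨hc, hc'⟩, ⟨hd, hd'⟩, hg⟩
    refine ⟨fun z => max (a z + d z) (c z + b z), fun z => b z + d z,
      ⟨(ha.add hU hd).sup hU (hc.add hU hb), (ha'.add hd').sup (hc'.add hb')⟩,
      ⟨hb.add hU hd, hb'.add hd'⟩, fun x => ?_⟩
    rw [ContinuousMap.sup_apply, hf, hg]
    rw [← max_sub_sub_right]
    congr 1 <;> ring
  have hneg : ∀ f ∈ L, -f ∈ L := by
    rintro f ⟨a, b, ha, hb, hf⟩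
    exact ⟨b, a, hb, ha, fun x => by simp [hf]⟩
  have hinf : ∀ f ∈ L, ∀ g ∈ L, f ⊓ g ∈ L := by
    intro f hf g hg
    have := hneg _ (hsup _ (hneg f hf) _ (hneg g hg))
    have e : f ⊓ g = -(-f ⊔ -g) := by
      ext x; simp [max_neg_neg]
    rwa [e]
  have hsep : L.SeparatesPointsStrongly := by
    intro v x y
    by_cases hxy : x = y
    · subst hxy
      exact ⟨ContinuousMap.const _ (v x), hharm (fun _ => (v x : ℂ)) _
        (fun _ => analyticAt_const) (by simp), by simp, by simp⟩
    · set e : ℂ := (y : ℂ) - x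
      have he : e ≠ 0 := sub_ne_zero.2 fun h => hxy (Subtype.ext h.symm)
      -- The affine function with values `v x` at `x` and `v y` at `y`; its real part is harmonic.
      set f : ℂ → ℂ := fun z => (v x : ℂ) + (v y - v x : ℝ) * ((z - x) / e) with hf
      have hfc : Continuous f := by simp only [hf]; fun_prop
      refine ⟨⟨fun z : frontier U => (f z).re, by fun_prop⟩, hharm f _ (fun z => ?_)
        fun _ => rfl, ?_, ?_⟩
      · simp only [hf]; fun_prop (disch := exact he)
      · simp [hf]
      · show (f y).re = v y
        have : f y = ((v y : ℝ) : ℂ) := by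
          simp only [hf]
          rw [show (y : ℂ) - x = e from rfl, div_self he]
          push_cast; ring
        rw [this, Complex.ofReal_re]
  have hne : L.Nonempty :=
    ⟨0, hharm (fun _ => 0) _ (fun _ => analyticAt_const) (by simp)⟩
  have hdense := ContinuousMap.sublattice_closure_eq_top L hne hinf hsup hsep
  have hgmem : g ∈ closure L := by rw [hdense]; trivial
  obtain ⟨s, hsL, hslim⟩ := mem_closure_iff_seq_limit.1 hgmem
  have hsol : ∀ n, ∃ h : ℂ → ℝ, HarmonicOnNhd h U ∧ ContinuousOn h (closure U) ∧
      ∀ x : frontier U, h x = s n x := by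
    intro n
    obtain ⟨a, b, ⟨ha, ha'⟩, ⟨hb1, hb'⟩, hs⟩ := hsL n
    obtain ⟨h1, h1h, h1c, h1e⟩ := ha.exists_dirichlet hU hb hreg ha'
    obtain ⟨h2, h2h, h2c, h2e⟩ := hb1.exists_dirichlet hU hb hreg hb'
    exact ⟨h1 - h2, h1h.sub h2h, h1c.sub h2c, fun x => by
      rw [Pi.sub_apply, h1e x.2, h2e x.2, hs]⟩
  choose h hh hc he using hsol
  exact exists_dirichlet_of_tendsto hU hb hh hc he hslim

end DirichletComplex

/-! ### Transfer to the Euclidean plane, and balayage. -/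

section DirichletPlane

open Metric Filter Topology InnerProductSpace

/-- The isometry between the Euclidean plane and `ℂ`. -/
noncomputable def planeToComplex : Plane ≃ₗᵢ[ℝ] ℂ := Complex.orthonormalBasisOneI.repr.symm

section Isometry

variable {E F : Type*} [NormedAddCommGroup E] [InnerProductSpace ℝ E] [FiniteDimensional ℝ E]
  [NormedAddCommGroup F] [InnerProductSpace ℝ F] [FiniteDimensional ℝ F]

lemma laplacian_comp_linearIsometryEquiv (e : E ≃ₗᵢ[ℝ] F) (f : F → ℝ) (x : E) :
    Laplacian.laplacian (fun y => f (e y)) x = Laplacian.laplacian f (e x) := by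
  rw [laplacian_eq_iteratedFDeriv_orthonormalBasis _ (stdOrthonormalBasis ℝ E),
    laplacian_eq_iteratedFDeriv_orthonormalBasis _ ((stdOrthonormalBasis ℝ E).map e)]
  refine Finset.sum_congr rfl fun i _ => ?_
  have := e.toContinuousLinearEquiv.iteratedFDerivWithin_comp_right (f := f) uniqueDiffOn_univ
    (mem_univ (e x)) 2
  simp only [preimage_univ, iteratedFDerivWithin_univ] at this
  have h2 : (fun y => f (e y)) = f ∘ e.toContinuousLinearEquiv := rfl
  rw [h2, this]
  simp only [ContinuousMultilinearMap.compContinuousLinearMap_apply]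
  congr 1
  ext j
  fin_cases j <;> simp

lemma harmonicAt_comp_linearIsometryEquiv (e : E ≃ₗᵢ[ℝ] F) {f : F → ℝ} {x : E}
    (hf : HarmonicAt f (e x)) : HarmonicAt (fun y => f (e y)) x := by
  refine ⟨ContDiffAt.comp x hf.1 e.contDiff.contDiffAt, ?_⟩
  filter_upwards [e.continuous.continuousAt.eventually hf.2] with y hy
  rw [laplacian_comp_linearIsometryEquiv, hy]; rfl

lemma harmonicContOnCl_comp_linearIsometryEquiv (e : E ≃ₗᵢ[ℝ] F) {f : F → ℝ} {s : Set F}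
    (hf : HarmonicContOnCl f s) : HarmonicContOnCl (fun y => f (e y)) (e ⁻¹' s) := by
  refine ⟨fun x hx => harmonicAt_comp_linearIsometryEquiv e (hf.1 _ hx), ?_⟩
  have : closure (e ⁻¹' s) = e ⁻¹' closure s := (e.toHomeomorph.preimage_closure s).symm
  rw [this]
  exact hf.2.comp e.continuous.continuousOn fun x hx => hx

end Isometry

variable {Ω : Set Plane}

lemma harmonicContOnCl_le_of_frontier (hΩ : IsOpen Ω) (hb : Bornology.IsBounded Ω) {h : Plane → ℝ}
    (hh : HarmonicContOnCl h Ω) {M : ℝ} (hM : ∀ z ∈ frontier Ω, h z ≤ M) :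
    ∀ z ∈ closure Ω, h z ≤ M := by
  set e := planeToComplex.symm
  have h1 := harmonicContOnCl_comp_linearIsometryEquiv e hh
  have hcl : closure (e ⁻¹' Ω) = e ⁻¹' closure Ω := (e.toHomeomorph.preimage_closure Ω).symm
  have hfr : frontier (e ⁻¹' Ω) = e ⁻¹' frontier Ω := (e.toHomeomorph.preimage_frontier Ω).symm
  have h2 := le_of_harmonic_of_frontier (hΩ.preimage e.continuous)
    (by
      have : e ⁻¹' Ω = e.symm '' Ω := (e.symm.toEquiv.image_eq_preimage_symm Ω).symm
      rw [this]
      exact e.symm.lipschitz.isBounded_image hb) h1.1 h1.2 (M := M) (by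
      rw [hfr]; exact fun z hz => hM _ hz)
  intro z hz
  simpa using h2 (e.symm z) (by rw [hcl]; simpa using hz)

lemma harmonicContOnCl_nonneg_of_frontier (hΩ : IsOpen Ω) (hb : Bornology.IsBounded Ω)
    {h : Plane → ℝ} (hh : HarmonicContOnCl h Ω) (hM : ∀ z ∈ frontier Ω, 0 ≤ h z) :
    ∀ z ∈ closure Ω, 0 ≤ h z := by
  intro z hz
  have := harmonicContOnCl_le_of_frontier hΩ hb (M := 0) (h := -h) ⟨hh.1.neg, hh.2.neg⟩
    (fun z hz => by simpa using hM z hz) z hz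
  simpa using this

lemma harmonicContOnCl_eqOn_of_frontier (hΩ : IsOpen Ω) (hb : Bornology.IsBounded Ω)
    {h k : Plane → ℝ} (hh : HarmonicContOnCl h Ω) (hk : HarmonicContOnCl k Ω)
    (hhk : ∀ z ∈ frontier Ω, h z = k z) : EqOn h k (closure Ω) := by
  intro z hz
  have h1 := harmonicContOnCl_nonneg_of_frontier hΩ hb (h := h - k)
    ⟨hh.1.sub hk.1, hh.2.sub hk.2⟩ (fun z hz => by simp [hhk z hz]) z hz
  have h2 := harmonicContOnCl_nonneg_of_frontier hΩ hb (h := k - h)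
    ⟨hk.1.sub hh.1, hk.2.sub hh.2⟩ (fun z hz => by simp [hhk z hz]) z hz
  simp only [Pi.sub_apply] at h1 h2
  linarith

/-- Solvability of the Dirichlet problem in a bounded open set bounded by `C¹` Jordan curves. -/
theorem exists_dirichlet_plane (hΩ : IsOpen Ω) (hb : Bornology.IsBounded Ω) {n : ℕ}
    {Γ : Fin n → Set Plane} (hΓ : ∀ i, IsC1JordanCurve (Γ i)) (hfr : frontier Ω = ⋃ i, Γ i)
    (g : C(frontier Ω, ℝ)) :
    ∃ h : Plane → ℝ, HarmonicContOnCl h Ω ∧ ∀ x : frontier Ω, h x = g x := by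
  set e := planeToComplex
  set U : Set ℂ := e.symm ⁻¹' Ω
  have hU : IsOpen U := hΩ.preimage e.symm.continuous
  have hUe : U = e '' Ω := (e.toEquiv.image_eq_preimage_symm Ω).symm
  have hUb : Bornology.IsBounded U := hUe ▸ e.lipschitz.isBounded_image hb
  have hUf : frontier U = e.symm ⁻¹' frontier Ω := (e.symm.toHomeomorph.preimage_frontier Ω).symm
  have hreg : ∀ p ∈ frontier U, ∃ β, IsBarrierAt β U p := by
    intro p hp
    have hp' : e.symm p ∈ ⋃ i, Γ i := by rw [← hfr]; rw [hUf] at hp; exact hp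
    obtain ⟨i, hi⟩ := mem_iUnion.1 hp'
    obtain ⟨γ, hγ, -, -, hγ', hγr⟩ := hΓ i
    rw [← hγr] at hi
    obtain ⟨t, ht⟩ := hi
    have hs : HasStrictDerivAt γ (deriv γ t) t := hγ.contDiffAt.hasStrictDerivAt one_ne_zero
    have hs' : HasStrictDerivAt (fun t => e (γ t)) (e (deriv γ t)) t :=
      e.toContinuousLinearEquiv.toContinuousLinearMap.hasStrictFDerivAt.comp_hasStrictDerivAt t hs
    obtain ⟨β, hβ⟩ := exists_barrier hU hs' (by simpa using hγ' t) (fun s hs => by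
      have h1 : γ s ∈ Ω := by simpa [U] using hs
      have h2 : γ s ∈ frontier Ω := by
        rw [hfr]; exact mem_iUnion.2 ⟨i, hγr ▸ mem_range_self s⟩
      rw [hΩ.frontier_eq] at h2
      exact h2.2 h1)
    refine ⟨β, ?_⟩
    have : e (γ t) = p := by rw [ht]; simp
    rwa [this] at hβ
  let g' : C(frontier U, ℝ) := g.comp ⟨fun z => ⟨e.symm z, hUf.subset z.2⟩, by fun_prop⟩
  obtain ⟨h, hh, hc, he⟩ := exists_dirichlet_complex hU hUb hreg g'
  refine ⟨fun x => h (e x), ?_, fun x => ?_⟩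
  · have := harmonicContOnCl_comp_linearIsometryEquiv e ⟨hh, hc⟩
    have h2 : e ⁻¹' U = Ω := by ext; simp [U]
    rwa [h2] at this
  · have hx : e x ∈ frontier U := by rw [hUf]; simp
    have := he ⟨e x, hx⟩
    simpa [g'] using this

lemma integrableOn_mul_of_continuousOn (hΩ : IsOpen Ω) (hb : Bornology.IsBounded Ω)
    {F h : Plane → ℝ} (hF : IntegrableOn F Ω) (hh : ContinuousOn h (closure Ω)) :
    IntegrableOn (fun x => F x * h x) Ω := by
  obtain ⟨C, hC⟩ := hb.isCompact_closure.exists_bound_of_continuousOn hh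
  refine Integrable.mul_bdd (c := C) hF ((hh.mono subset_closure).aestronglyMeasurable hΩ.measurableSet) ?_
  filter_upwards [ae_restrict_mem hΩ.measurableSet] with x hx
  exact hC x (subset_closure hx)

open CompactlySupported in
/-- **Balayage** of a nonnegative integrable function onto the boundary. -/
theorem exists_balayage (hΩ : IsOpen Ω) (hb : Bornology.IsBounded Ω)
    (hsolv : ∀ g : C(frontier Ω, ℝ), ∃ h : Plane → ℝ, HarmonicContOnCl h Ω ∧
      ∀ x : frontier Ω, h x = g x) {F : Plane → ℝ} (hF : IntegrableOn F Ω) (hF0 : ∀ x, 0 ≤ F x) :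
    ∃ ν : Measure Plane, IsFiniteMeasure ν ∧ ν univ = ENNReal.ofReal (∫ x in Ω, F x) ∧
      ∀ h φ : Plane → ℝ, HarmonicContOnCl h Ω → ContinuousOn φ (frontier Ω) →
        EqOn h φ (frontier Ω) → ∫ x, φ x ∂ν = ∫ x in Ω, F x * h x := by
  have hcomp : CompactSpace (frontier Ω) :=
    isCompact_iff_compactSpace.1 (hb.isCompact_closure.of_isClosed_subset isClosed_frontier
      frontier_subset_closure)
  choose H hH hHe using hsolv
  have hint : ∀ g, IntegrableOn (fun x => F x * H g x) Ω := fun g =>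
    integrableOn_mul_of_continuousOn hΩ hb hF (hH g).2
  have hadd : ∀ g k, EqOn (H (g + k)) (H g + H k) (closure Ω) := fun g k =>
    harmonicContOnCl_eqOn_of_frontier hΩ hb (hH _) ⟨(hH g).1.add (hH k).1, (hH g).2.add (hH k).2⟩
      fun z hz => by
        have := hHe (g + k) ⟨z, hz⟩; have h2 := hHe g ⟨z, hz⟩; have h3 := hHe k ⟨z, hz⟩
        simp at this h2 h3 ⊢; rw [this, h2, h3]
  have hsmul : ∀ (c : ℝ) g, EqOn (H (c • g)) (c • H g) (closure Ω) := fun c g =>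
    harmonicContOnCl_eqOn_of_frontier hΩ hb (hH _) ⟨(hH g).1.const_smul, (hH g).2.const_smul c⟩
      fun z hz => by
        have := hHe (c • g) ⟨z, hz⟩; have h2 := hHe g ⟨z, hz⟩
        simp at this h2 ⊢; rw [this, h2]
  -- Integrating the harmonic extension against `F` is linear by uniqueness and positive by the
  -- maximum principle, hence given by a measure on the compact boundary.
  let Λ₀ : C_c(frontier Ω, ℝ) →ₗ[ℝ] ℝ :=
    { toFun := fun g => ∫ x in Ω, F x * H g.toContinuousMap x
      map_add' := fun g k => by
        rw [← integral_add (hint _) (hint _)]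
        refine setIntegral_congr_fun hΩ.measurableSet fun x hx => ?_
        have := hadd g.toContinuousMap k.toContinuousMap (subset_closure hx)
        simp only [Pi.add_apply] at this
        show F x * H (g.toContinuousMap + k.toContinuousMap) x = _
        rw [this, mul_add]
      map_smul' := fun c g => by
        rw [RingHom.id_apply, smul_eq_mul, ← integral_const_mul]
        refine setIntegral_congr_fun hΩ.measurableSet fun x hx => ?_
        have := hsmul c g.toContinuousMap (subset_closure hx)
        simp only [Pi.smul_apply, smul_eq_mul] at this
        show F x * H (c • g.toContinuousMap) x = _
        rw [this]; ring }
  have hpos : ∀ g : C_c(frontier Ω, ℝ), 0 ≤ g → 0 ≤ Λ₀ g := by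
    intro g hg
    refine setIntegral_nonneg hΩ.measurableSet fun x hx => mul_nonneg (hF0 x) ?_
    refine harmonicContOnCl_nonneg_of_frontier hΩ hb (hH _) (fun z hz => ?_) x (subset_closure hx)
    have := hHe g.toContinuousMap ⟨z, hz⟩
    simp only at this
    rw [this]
    exact hg ⟨z, hz⟩
  let Λ : C_c(frontier Ω, ℝ) →ₚ[ℝ] ℝ :=
    { Λ₀ with
      monotone' := fun g k hgk => by
        have := hpos (k - g) (sub_nonneg.2 hgk)
        rw [map_sub] at this
        exact sub_nonneg.1 this }
  set ν₀ := RealRMK.rieszMeasure Λ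
  have hrep : ∀ g : C(frontier Ω, ℝ), ∫ x, g x ∂ν₀ = ∫ x in Ω, F x * H g x := fun g =>
    RealRMK.integral_rieszMeasure Λ (CompactlySupportedContinuousMap.continuousMapEquiv g)
  have hfin : IsFiniteMeasure ν₀ := ⟨isCompact_univ.measure_lt_top⟩
  have hrep' : ∀ h φ : Plane → ℝ, HarmonicContOnCl h Ω → ContinuousOn φ (frontier Ω) →
        EqOn h φ (frontier Ω) → ∫ x : frontier Ω, φ x ∂ν₀ = ∫ x in Ω, F x * h x := by
    intro h φ hh hφ he
    have := hrep ⟨fun x => φ x, hφ.domRestrict⟩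
    refine this.trans ?_
    refine setIntegral_congr_fun hΩ.measurableSet fun x hx => ?_
    congr 1
    refine harmonicContOnCl_eqOn_of_frontier hΩ hb (hH _) hh (fun z hz => ?_) (subset_closure hx)
    have := hHe ⟨fun x => φ x, hφ.domRestrict⟩ ⟨z, hz⟩
    rw [he hz]; exact this
  have hemb : MeasurableEmbedding (Subtype.val : frontier Ω → Plane) :=
    MeasurableEmbedding.subtype_coe isClosed_frontier.measurableSet
  refine ⟨ν₀.map Subtype.val, inferInstance, ?_, fun h φ hh hφ he => ?_⟩
  -- The constant `1` is its own harmonic extension, which gives the total mass.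
  · have h1 := hrep' (fun _ => 1) (fun _ => 1)
      ⟨harmonicOnNhd_const 1, continuousOn_const⟩ continuousOn_const fun _ _ => rfl
    simp only [mul_one, integral_const, smul_eq_mul] at h1
    rw [← h1, hemb.map_apply, preimage_univ]
    exact (ofReal_measureReal (measure_ne_top _ _)).symm
  · rw [hemb.integral_map]
    exact hrep' h φ hh hφ he

end DirichletPlane

/-! ### The Laplacian of the zero extension as a difference of measures. -/

section DualityFormula

open Metric Filter Topology InnerProductSpace

variable {Ω : Set Plane}

lemma continuous_laplacian {φ : Plane → ℝ} (hφ : ContDiff ℝ 2 φ) :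
    Continuous (Laplacian.laplacian φ) := by
  rw [laplacian_eq_iteratedFDeriv_stdOrthonormalBasis]
  refine continuous_finsetSum _ fun i _ => ?_
  have : Continuous (iteratedFDeriv ℝ 2 φ) := hφ.continuous_iteratedFDeriv le_rfl
  fun_prop

lemma laplacian_sub_of_harmonicAt {φ h : Plane → ℝ} {x : Plane} (hφ : ContDiff ℝ 2 φ)
    (hh : HarmonicAt h x) : Laplacian.laplacian (φ - h) x = Laplacian.laplacian φ x := by
  rw [hφ.contDiffAt.laplacian_sub hh.1, hh.2.self_of_nhds]
  simp

lemma isDirichletTest_sub (hb : Bornology.IsBounded Ω) {φ h : Plane → ℝ} (hφ : ContDiff ℝ 2 φ)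
    (hh : HarmonicContOnCl h Ω) (he : EqOn h φ (frontier Ω)) : IsDirichletTest Ω (φ - h) where
  continuousOn := hφ.continuous.continuousOn.sub hh.2
  contDiffOn := hφ.contDiffOn.sub hh.1.contDiffOn
  boundary x hx := by simp [he hx]
  bounded_laplacian := by
    obtain ⟨C, hC⟩ := hb.isCompact_closure.exists_bound_of_continuousOn
      (continuous_laplacian hφ).continuousOn
    refine ⟨C, fun x hx => ?_⟩
    rw [laplacian_sub_of_harmonicAt hφ (hh.1 x hx)]
    exact hC x (subset_closure hx)

/-- Subtracting from `φ` the harmonic function with the same boundary values makes it admissible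
without changing its Laplacian in `Ω`. -/
lemma IsDirichletSolution.integral_laplacian (hΩ : IsOpen Ω) (hb : Bornology.IsBounded Ω)
    {f u : Plane → ℝ} (hu : IsDirichletSolution Ω f u) (hf : IntegrableOn f Ω)
    {φ h : Plane → ℝ} (hφ : ContDiff ℝ 2 φ)
    (hh : HarmonicContOnCl h Ω) (he : EqOn h φ (frontier Ω)) :
    ∫ x in Ω, u x * Laplacian.laplacian φ x = (∫ x in Ω, f x * φ x) - ∫ x in Ω, f x * h x := by
  rw [← integral_sub (integrableOn_mul_of_continuousOn hΩ hb hf hφ.continuous.continuousOn)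
    (integrableOn_mul_of_continuousOn hΩ hb hf hh.2)]
  simp_rw [← mul_sub]
  have := hu.integral_eq _ (isDirichletTest_sub hb hφ hh he)
  simp only [Pi.sub_apply] at this
  rw [← this]
  refine setIntegral_congr_fun hΩ.measurableSet fun x hx => ?_
  rw [laplacian_sub_of_harmonicAt hφ (hh.1 x hx)]

lemma integral_withDensity_ofReal {f φ : Plane → ℝ} (hf : IntegrableOn f Ω) :
    ∫ x, φ x ∂(volume.restrict Ω).withDensity (fun x => ENNReal.ofReal (f x)) =
      ∫ x in Ω, max (f x) 0 * φ x := by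
  rw [integral_withDensity_eq_integral_toReal_smul₀ hf.aestronglyMeasurable.aemeasurable.ennreal_ofReal
    (Eventually.of_forall fun x => ENNReal.ofReal_lt_top)]
  simp [ENNReal.toReal_ofReal']

lemma withDensity_ofReal_univ {f : Plane → ℝ} (hf : IntegrableOn f Ω) :
    (volume.restrict Ω).withDensity (fun x => ENNReal.ofReal (f x)) univ =
      ENNReal.ofReal (∫ x in Ω, max (f x) 0) := by
  rw [withDensity_apply _ MeasurableSet.univ, Measure.restrict_univ,
    ofReal_integral_eq_lintegral_ofReal hf.pos_part (Eventually.of_forall fun x => le_max_right _ _)]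
  simp

/-- The solution, extended by zero, has a Laplacian which is a difference of two measures
whose mass is at most the norm of the datum. -/
theorem IsDirichletSolution.exists_measures (hΩ : IsOpen Ω) (hb : Bornology.IsBounded Ω)
    (hsolv : ∀ g : C(frontier Ω, ℝ), ∃ h : Plane → ℝ, HarmonicContOnCl h Ω ∧
      ∀ x : frontier Ω, h x = g x) {f u : Plane → ℝ} (hf : IntegrableOn f Ω)
    (hu : IsDirichletSolution Ω f u) :
    ∃ μ ν : Measure Plane, IsFiniteMeasure μ ∧ IsFiniteMeasure ν ∧
      μ univ = eLpNorm f 1 (volume.restrict Ω) ∧ ν univ = eLpNorm f 1 (volume.restrict Ω) ∧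
      ∀ φ : Plane → ℝ, ContDiff ℝ 2 φ → (∃ C, ∀ x, ‖φ x‖ ≤ C) →
        ∫ x in Ω, u x * Laplacian.laplacian φ x = (∫ x, φ x ∂μ) - ∫ x, φ x ∂ν := by
  have hp : IntegrableOn (fun x => max (f x) 0) Ω := hf.pos_part
  have hn : IntegrableOn (fun x => max (-f x) 0) Ω := hf.neg_part
  obtain ⟨νp, hνp, hνpm, hνpi⟩ := exists_balayage hΩ hb hsolv hp fun x => le_max_right _ _
  obtain ⟨νn, hνn, hνnm, hνni⟩ := exists_balayage hΩ hb hsolv hn fun x => le_max_right _ _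
  set μp := (volume.restrict Ω).withDensity (fun x => ENNReal.ofReal (f x))
  set μn := (volume.restrict Ω).withDensity (fun x => ENNReal.ofReal (-f x))
  have hμpm : μp univ = _ := withDensity_ofReal_univ hf
  have hμnm : μn univ = _ := withDensity_ofReal_univ hf.neg
  have hμp : IsFiniteMeasure μp := ⟨by rw [hμpm]; exact ENNReal.ofReal_lt_top⟩
  have hμn : IsFiniteMeasure μn := ⟨by rw [hμnm]; exact ENNReal.ofReal_lt_top⟩
  have hnorm : ENNReal.ofReal (∫ x in Ω, max (f x) 0) + ENNReal.ofReal (∫ x in Ω, max (-f x) 0) =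
      eLpNorm f 1 (volume.restrict Ω) := by
    have h1 : 0 ≤ ∫ x in Ω, max (f x) 0 := integral_nonneg fun x => le_max_right (f x) 0
    have h2 : 0 ≤ ∫ x in Ω, max (-f x) 0 := integral_nonneg fun x => le_max_right (-f x) 0
    rw [← ENNReal.ofReal_add h1 h2, ← integral_add hp hn,
      eLpNorm_one_eq_lintegral_enorm, ← ofReal_integral_norm_eq_lintegral_enorm hf]
    congr 2
    ext x
    rw [Real.norm_eq_abs]
    rcases le_total 0 (f x) with h | h
    · rw [max_eq_left h, max_eq_right (by linarith), abs_of_nonneg h, add_zero]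
    · rw [max_eq_right h, max_eq_left (by linarith), abs_of_nonpos h, zero_add]
  -- Regrouping by sign, `∫ f φ - ∫ f h = (∫ f⁺ φ + ∫ f⁻ h) - (∫ f⁻ φ + ∫ f⁺ h)`; each group has
  -- mass `∫ f⁺ + ∫ f⁻`.
  refine ⟨μp + νn, μn + νp, inferInstance, inferInstance, ?_, ?_, fun φ hφ hbd => ?_⟩
  · rw [Measure.add_apply, hμpm, hνnm, hnorm]
  · rw [Measure.add_apply, hμnm, hνpm, add_comm, ← hnorm]
  obtain ⟨C, hC⟩ := hbd
  have hint : ∀ (m : Measure Plane) [IsFiniteMeasure m], Integrable φ m := fun m _ =>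
    Integrable.of_bound hφ.continuous.aestronglyMeasurable C (Eventually.of_forall hC)
  obtain ⟨h, hh, hhe⟩ := hsolv ⟨fun x => φ x, by have := hφ.continuous; fun_prop⟩
  have he : EqOn h φ (frontier Ω) := fun x hx => hhe ⟨x, hx⟩
  have hfc := hφ.continuous.continuousOn (s := frontier Ω)
  rw [hu.integral_laplacian hΩ hb hf hφ hh he, integral_add_measure (hint _) (hint _),
    integral_add_measure (hint _) (hint _), hνpi h φ hh hfc he, hνni h φ hh hfc he,
    integral_withDensity_ofReal hf, integral_withDensity_ofReal (f := fun x => -f x) hf.neg]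
  have hsplit : ∀ k : Plane → ℝ, ContinuousOn k (closure Ω) → ∫ x in Ω, f x * k x =
      (∫ x in Ω, max (f x) 0 * k x) - ∫ x in Ω, max (-f x) 0 * k x := by
    intro k hk
    rw [← integral_sub (integrableOn_mul_of_continuousOn hΩ hb hp hk)
      (integrableOn_mul_of_continuousOn hΩ hb hn hk)]
    congr 1
    ext x
    rw [← sub_mul]
    congr 1
    rcases le_total 0 (f x) with h | h
    · rw [max_eq_left h, max_eq_right (by linarith), sub_zero]
    · rw [max_eq_right h, max_eq_left (by linarith), zero_sub, neg_neg]
  rw [hsplit φ hφ.continuous.continuousOn, hsplit h hh.2]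
  ring

end DualityFormula

/-! ### The gradient kernel and its integral over sets of given area. -/

section Kernel

open Metric Filter Topology InnerProductSpace Real

/-- The gradient of the fundamental solution of the Laplacian in the plane. -/
noncomputable def gradKernel (z : Plane) : Plane := (2 * π * ‖z‖ ^ 2)⁻¹ • z

lemma norm_gradKernel (z : Plane) : ‖gradKernel z‖ = (2 * π)⁻¹ * ‖z‖⁻¹ := by
  rw [gradKernel, norm_smul, Real.norm_of_nonneg (by positivity)]
  rcases eq_or_ne z 0 with rfl | hz
  · simp
  · have := norm_ne_zero_iff.2 hz
    field_simp

lemma gradKernel_neg (z : Plane) : gradKernel (-z) = - gradKernel z := by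
  simp [gradKernel]

lemma measurable_gradKernel : Measurable gradKernel := by
  unfold gradKernel; fun_prop

/-- The integrand is `(1/‖z‖ - 1/r)⁺` away from the origin, the excess needed in the rearrangement
estimate `setLIntegral_gradKernel_le`. -/
lemma integrable_truncated_inv_norm {r : ℝ} :
    Integrable (fun z : Plane => (Ioo 0 r).indicator (fun s => s⁻¹ - r⁻¹) ‖z‖) volume := by
  rw [integrable_fun_norm_addHaar volume (f := (Ioo 0 r).indicator fun s => s⁻¹ - r⁻¹)]
  have h1 : IntegrableOn (fun y : ℝ => 1 - y * r⁻¹) (Ioo 0 r) :=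
    (Continuous.integrableOn_Icc (by fun_prop)).mono_set Ioo_subset_Icc_self
  have h2 : Integrable ((Ioo 0 r).indicator fun y : ℝ => 1 - y * r⁻¹) :=
    h1.integrable_indicator measurableSet_Ioo
  refine h2.integrableOn.congr_fun (fun y hy => ?_) measurableSet_Ioi
  have hy0 : 0 < y := hy
  by_cases hyr : y < r
  · simp [hy0, hyr, mul_sub, hy0.ne']
  · simp [hyr]

lemma integral_truncated_inv_norm {r : ℝ} (hr : 0 < r) :
    ∫ z : Plane, (Ioo 0 r).indicator (fun s => s⁻¹ - r⁻¹) ‖z‖ = π * r := by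
  rw [integral_fun_norm_addHaar volume ((Ioo 0 r).indicator fun s => s⁻¹ - r⁻¹)]
  have h1 : ∫ y in Ioi (0 : ℝ), y ^ (Module.finrank ℝ Plane - 1) •
      (Ioo 0 r).indicator (fun s => s⁻¹ - r⁻¹) y = r / 2 := by
    have : ∀ y ∈ Ioi (0 : ℝ), y ^ (Module.finrank ℝ Plane - 1) •
        (Ioo 0 r).indicator (fun s => s⁻¹ - r⁻¹) y =
        (Ioo 0 r).indicator (fun y : ℝ => 1 - y * r⁻¹) y := by
      intro y hy
      have hy0 : 0 < y := hy
      by_cases hyr : y < r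
      · simp [hy0, hyr, mul_sub, hy0.ne']
      · simp [hyr]
    rw [setIntegral_congr_fun measurableSet_Ioi this, setIntegral_indicator measurableSet_Ioo,
      inter_eq_right.2 (fun x hx => hx.1), ← integral_Ioc_eq_integral_Ioo,
      ← intervalIntegral.integral_of_le hr.le, intervalIntegral.integral_sub (by simp)
      (Continuous.intervalIntegrable (by fun_prop) _ _), intervalIntegral.integral_mul_const]
    simp
    field_simp
    ring
  rw [h1]
  have h2 : volume.real (ball (0 : Plane) 1) = π := by
    rw [measureReal_def, EuclideanSpace.volume_ball_fin_two]
    simp [pi_nonneg]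
  rw [h2]
  simp
  ring

/-- Among sets of given area, the discs centred at `x` maximize the integral of the kernel. -/
lemma setLIntegral_gradKernel_le (E : Set Plane) (hE : volume E ≠ ⊤) (x : Plane) :
    ∫⁻ y in E, ‖gradKernel (y - x)‖ₑ ≤ ENNReal.ofReal √((volume E).toReal / π) := by
  rcases eq_or_ne (volume E) 0 with h0 | h0
  · rw [Measure.restrict_eq_zero.2 h0]; simp
  set m := (volume E).toReal with hm
  have hm0 : 0 < m := ENNReal.toReal_pos h0 hE
  -- The radius of the disc with the area of `E`. Integrating `1/‖z‖ ≤ 1/r + (1/‖z‖ - 1/r)⁺`, the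
  -- first term over `E` and the second over the plane, gives `m/r + πr = 2πr`, the exact value for
  -- the disc.
  set r := √(m / π) with hr
  have hr0 : 0 < r := Real.sqrt_pos.2 (div_pos hm0 pi_pos)
  have hr2 : m = π * r ^ 2 := by
    rw [hr, Real.sq_sqrt (by positivity)]; field_simp
  set T : ℝ → ℝ := (Ioo 0 r).indicator fun s => s⁻¹ - r⁻¹ with hT
  have hT0 : ∀ s, 0 ≤ T s := fun s =>
    indicator_nonneg (fun s hs => sub_nonneg.2 (inv_anti₀ hs.1 hs.2.le)) s
  have hle : ∀ z : Plane, ‖z‖⁻¹ ≤ r⁻¹ + T ‖z‖ := by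
    intro z
    by_cases hz : ‖z‖ ∈ Ioo 0 r
    · rw [hT, indicator_of_mem hz]; linarith
    · rw [hT, indicator_of_notMem hz, add_zero]
      rcases eq_or_lt_of_le (norm_nonneg z) with h | h
      · rw [← h, inv_zero]; positivity
      · exact inv_anti₀ hr0 (not_lt.1 fun hlt => hz ⟨h, hlt⟩)
  have hc : 0 ≤ (2 * π)⁻¹ := by positivity
  have hpt : ∀ y, ‖gradKernel (y - x)‖ₑ ≤
      ENNReal.ofReal ((2 * π)⁻¹ * r⁻¹) + ENNReal.ofReal ((2 * π)⁻¹ * T ‖y - x‖) := by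
    intro y
    rw [← ENNReal.ofReal_add (by positivity) (mul_nonneg hc (hT0 _)), ← mul_add,
      ← ofReal_norm, norm_gradKernel]
    exact ENNReal.ofReal_le_ofReal (mul_le_mul_of_nonneg_left (hle _) hc)
  have hTint : Integrable (fun z : Plane => (2 * π)⁻¹ * T ‖z‖) volume :=
    integrable_truncated_inv_norm.const_mul _
  calc ∫⁻ y in E, ‖gradKernel (y - x)‖ₑ
      ≤ ∫⁻ y in E, (ENNReal.ofReal ((2 * π)⁻¹ * r⁻¹) +
        ENNReal.ofReal ((2 * π)⁻¹ * T ‖y - x‖)) := lintegral_mono hpt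
    _ = ENNReal.ofReal ((2 * π)⁻¹ * r⁻¹) * volume E +
        ∫⁻ y in E, ENNReal.ofReal ((2 * π)⁻¹ * T ‖y - x‖) := by
      rw [lintegral_add_left measurable_const, setLIntegral_const]
    _ ≤ ENNReal.ofReal ((2 * π)⁻¹ * r⁻¹) * volume E +
        ∫⁻ y, ENNReal.ofReal ((2 * π)⁻¹ * T ‖y - x‖) := by
      gcongr; exact Measure.restrict_le_self
    _ = ENNReal.ofReal ((2 * π)⁻¹ * r⁻¹) * ENNReal.ofReal m +
        ENNReal.ofReal ((2 * π)⁻¹ * (π * r)) := by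
      rw [hm, ENNReal.ofReal_toReal hE,
        lintegral_sub_right_eq_self (fun z : Plane => ENNReal.ofReal ((2 * π)⁻¹ * T ‖z‖)) x,
        ← ofReal_integral_eq_lintegral_ofReal hTint
          (Eventually.of_forall fun z => mul_nonneg hc (hT0 _)), integral_const_mul,
        integral_truncated_inv_norm hr0]
    _ = ENNReal.ofReal r := by
      rw [← ENNReal.ofReal_mul (by positivity), ← ENNReal.ofReal_add (by positivity)
        (by positivity), hr2]
      congr 1
      field_simp
      ring

lemma locallyIntegrable_gradKernel : LocallyIntegrable gradKernel (volume : Measure Plane) := by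
  intro x
  refine ⟨ball x 1, ball_mem_nhds x one_pos, measurable_gradKernel.aestronglyMeasurable, ?_⟩
  have := setLIntegral_gradKernel_le (ball x 1) measure_ball_lt_top.ne 0
  simp only [sub_zero] at this
  exact this.trans_lt ENNReal.ofReal_lt_top

end Kernel

/-! ### Divergence and curl of the kernel in polar coordinates. -/

section Polar

open Metric Filter Topology InnerProductSpace Real

/-- The rotation by a right angle in the plane. -/
noncomputable def quarterTurn (z : Plane) : Plane := !₂[-z 1, z 0]

/-- The unit vector with a given argument. -/
noncomputable def unitVec (θ : ℝ) : Plane :=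
  cos θ • EuclideanSpace.single 0 1 + sin θ • EuclideanSpace.single 1 1

lemma norm_unitVec (θ : ℝ) : ‖unitVec θ‖ = 1 := by
  rw [EuclideanSpace.norm_eq, Real.sqrt_eq_one]
  simp [unitVec, Fin.sum_univ_two]

lemma norm_quarterTurn (z : Plane) : ‖quarterTurn z‖ = ‖z‖ := by
  rw [EuclideanSpace.norm_eq, EuclideanSpace.norm_eq]
  simp [quarterTurn, Fin.sum_univ_two, add_comm]

lemma continuous_quarterTurn : Continuous quarterTurn := by
  unfold quarterTurn; fun_prop

lemma quarterTurn_smul (r : ℝ) (z : Plane) : quarterTurn (r • z) = r • quarterTurn z := by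
  ext i; fin_cases i <;> simp [quarterTurn]

lemma continuous_unitVec : Continuous unitVec := by
  unfold unitVec; fun_prop

lemma hasDerivAt_unitVec (θ : ℝ) : HasDerivAt unitVec (quarterTurn (unitVec θ)) θ := by
  have h := ((hasDerivAt_cos θ).smul_const (EuclideanSpace.single 0 1 : Plane)).add
    ((hasDerivAt_sin θ).smul_const (EuclideanSpace.single 1 1 : Plane))
  have e : quarterTurn (unitVec θ) = -sin θ • (EuclideanSpace.single 0 1 : Plane) +
      cos θ • (EuclideanSpace.single 1 1 : Plane) := by
    ext i; fin_cases i <;> simp [quarterTurn, unitVec]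
  rw [e]
  exact h

lemma integral_polar_plane (F : Plane → ℝ) :
    ∫ p in Ioi (0 : ℝ) ×ˢ Ioo (-π) π, p.1 * F (p.1 • unitVec p.2) = ∫ z, F z := by
  rw [← (planeToComplex.symm.measurePreserving).integral_comp
    planeToComplex.symm.toHomeomorph.measurableEmbedding, ← Complex.integral_comp_polarCoord_symm,
    polarCoord_target]
  refine setIntegral_congr_fun (measurableSet_Ioi.prod measurableSet_Ioo) fun p hp => ?_
  simp only [smul_eq_mul]
  congr 2
  rw [LinearIsometryEquiv.eq_symm_apply]
  simp [planeToComplex, Complex.orthonormalBasisOneI_repr_symm_apply, unitVec]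
  ring

variable {ψ : Plane → ℝ}

/-- The polar Jacobian cancels the singularity of the kernel, leaving a continuous integrand of
bounded radial support; this justifies Fubini in `(r, θ)`. -/
lemma integrableOn_polar_of_hasCompactSupport {L : Plane → Plane → ℝ} {x : Plane}
    (hL : Continuous fun p : Plane × Plane => L p.1 p.2) {R : ℝ}
    (hR : ∀ z, R ≤ ‖z‖ → ∀ w, L (x - z) w = 0) {V : ℝ → Plane} (hV : Continuous V) :
    IntegrableOn (fun p : ℝ × ℝ => L (x - p.1 • unitVec p.2) (V p.2))
      (Ioi (0 : ℝ) ×ˢ Ioo (-π) π) (volume.prod volume) := by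
  have hu := continuous_unitVec
  have hc : Continuous fun p : ℝ × ℝ => L (x - p.1 • unitVec p.2) (V p.2) :=
    hL.comp (by fun_prop : Continuous fun p : ℝ × ℝ => (x - p.1 • unitVec p.2, V p.2))
  have h1 : IntegrableOn (fun p : ℝ × ℝ => L (x - p.1 • unitVec p.2) (V p.2))
      (Icc 0 R ×ˢ Icc (-π) π) (volume.prod volume) :=
    hc.continuousOn.integrableOn_compact (isCompact_Icc.prod isCompact_Icc)
  refine h1.of_forall_sdiff_eq_zero (measurableSet_Ioi.prod measurableSet_Ioo) ?_
  rintro ⟨r, θ⟩ ⟨⟨hr, hθ⟩, hn⟩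
  refine hR _ ?_ _
  have hr : 0 < r := hr
  rw [norm_smul, norm_unitVec, mul_one, Real.norm_of_nonneg hr.le]
  by_contra hlt
  exact hn ⟨⟨hr.le, (not_le.1 hlt).le⟩, ⟨hθ.1.le, hθ.2.le⟩⟩

lemma exists_radius_fderiv_eq_zero (hc : HasCompactSupport ψ) (x : Plane) :
    ∃ R : ℝ, ∀ z, R ≤ ‖z‖ → fderiv ℝ ψ (x - z) = 0 ∧ ψ (x - z) = 0 := by
  obtain ⟨R, hR⟩ := hc.isCompact.isBounded.subset_closedBall x
  refine ⟨R + 1, fun z hz => ?_⟩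
  have : x - z ∉ tsupport ψ := fun h => by
    have := hR h
    rw [mem_closedBall, dist_eq_norm] at this
    simp at this
    linarith
  exact ⟨image_eq_zero_of_notMem_tsupport fun h => this (tsupport_fderiv_subset ℝ h),
    image_eq_zero_of_notMem_tsupport this⟩

lemma continuous_fderiv_apply_pair (hψ : ContDiff ℝ 1 ψ) :
    Continuous fun p : Plane × Plane => fderiv ℝ ψ p.1 p.2 :=
  ((hψ.continuous_fderiv one_ne_zero).comp continuous_fst).clm_apply continuous_snd

/-- The gradient kernel is a fundamental solution of the divergence operator. -/
lemma integral_fderiv_gradKernel (hψ : ContDiff ℝ 1 ψ) (hc : HasCompactSupport ψ) (x : Plane) :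
    ∫ z, (2 * π * ‖z‖ ^ 2)⁻¹ * fderiv ℝ ψ (x - z) z = ψ x := by
  obtain ⟨R, hR⟩ := exists_radius_fderiv_eq_zero hc x
  have hint := integrableOn_polar_of_hasCompactSupport (x := x)
    (L := fun z w => fderiv ℝ ψ z w) (continuous_fderiv_apply_pair hψ)
    (fun z hz w => by rw [(hR z hz).1]; rfl) continuous_unitVec
  rw [← integral_polar_plane]
  have h1 : ∀ p ∈ Ioi (0 : ℝ) ×ˢ Ioo (-π) π, p.1 * ((2 * π * ‖p.1 • unitVec p.2‖ ^ 2)⁻¹ *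
      fderiv ℝ ψ (x - p.1 • unitVec p.2) (p.1 • unitVec p.2)) =
      (2 * π)⁻¹ * fderiv ℝ ψ (x - p.1 • unitVec p.2) (unitVec p.2) := by
    rintro p ⟨hp, -⟩
    have hp : 0 < p.1 := hp
    rw [norm_smul, norm_unitVec, mul_one, Real.norm_of_nonneg hp.le, map_smul, smul_eq_mul]
    field_simp
  rw [setIntegral_congr_fun (measurableSet_Ioi.prod measurableSet_Ioo) h1, integral_const_mul,
    Measure.volume_eq_prod, ← Measure.prod_restrict]
  rw [IntegrableOn, ← Measure.prod_restrict] at hint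
  rw [integral_prod_symm _ hint]
  -- What remains is minus the derivative of `ψ` along a ray from `x`, so each direction contributes
  -- `ψ x`.
  have h2 : ∀ θ, ∫ r in Ioi (0 : ℝ), fderiv ℝ ψ (x - r • unitVec θ) (unitVec θ) = ψ x := by
    intro θ
    have hd : ∀ r, HasDerivAt (fun r : ℝ => ψ (x - r • unitVec θ))
        (-fderiv ℝ ψ (x - r • unitVec θ) (unitVec θ)) r := by
      intro r
      have h := ((hψ.differentiable one_ne_zero) (x - r • unitVec θ)).hasFDerivAt
      have h' : HasDerivAt (fun r : ℝ => x - r • unitVec θ) (-unitVec θ) r := by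
        simpa using ((hasDerivAt_id r).smul_const (unitVec θ)).const_sub x
      have h3 := h.comp_hasDerivAt r h'
      rw [map_neg] at h3
      exact h3
    have hcs : HasCompactSupport fun r : ℝ => ψ (x - r • unitVec θ) := by
      refine HasCompactSupport.of_support_subset_isCompact (isCompact_closedBall (0 : ℝ) R) ?_
      intro r hr
      by_contra hn
      refine hr (hR _ ?_).2
      rw [norm_smul, norm_unitVec, mul_one]
      simp at hn
      simpa using hn.le
    have := hcs.integral_Ioi_deriv_eq (by fun_prop) 0
    simp_rw [fun r => (hd r).deriv] at this
    rw [integral_neg, neg_inj] at this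
    simpa using this
  simp_rw [h2]
  rw [setIntegral_const, smul_eq_mul, measureReal_def, Real.volume_Ioo, ENNReal.toReal_ofReal
    (by linarith [pi_pos])]
  have := pi_pos
  field_simp
  ring

/-- The gradient kernel is curl free. -/
lemma integral_fderiv_quarterTurn (hψ : ContDiff ℝ 1 ψ) (hc : HasCompactSupport ψ) (x : Plane) :
    ∫ z, (2 * π * ‖z‖ ^ 2)⁻¹ * fderiv ℝ ψ (x - z) (quarterTurn z) = 0 := by
  obtain ⟨R, hR⟩ := exists_radius_fderiv_eq_zero hc x
  have hint := integrableOn_polar_of_hasCompactSupport (x := x)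
    (L := fun z w => fderiv ℝ ψ z w) (continuous_fderiv_apply_pair hψ)
    (fun z hz w => by rw [(hR z hz).1]; rfl) (V := fun θ => quarterTurn (unitVec θ))
    (continuous_quarterTurn.comp continuous_unitVec)
  rw [← integral_polar_plane]
  have h1 : ∀ p ∈ Ioi (0 : ℝ) ×ˢ Ioo (-π) π, p.1 * ((2 * π * ‖p.1 • unitVec p.2‖ ^ 2)⁻¹ *
      fderiv ℝ ψ (x - p.1 • unitVec p.2) (quarterTurn (p.1 • unitVec p.2))) =
      (2 * π)⁻¹ * fderiv ℝ ψ (x - p.1 • unitVec p.2) (quarterTurn (unitVec p.2)) := by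
    rintro p ⟨hp, -⟩
    have hp : 0 < p.1 := hp
    rw [norm_smul, norm_unitVec, mul_one, Real.norm_of_nonneg hp.le, quarterTurn_smul, map_smul,
      smul_eq_mul]
    field_simp
  rw [setIntegral_congr_fun (measurableSet_Ioi.prod measurableSet_Ioo) h1, integral_const_mul,
    Measure.volume_eq_prod, setIntegral_prod _ hint]
  have h2 : ∀ r ∈ Ioi (0 : ℝ), ∫ θ in Ioo (-π) π,
      fderiv ℝ ψ (x - r • unitVec θ) (quarterTurn (unitVec θ)) = 0 := by
    intro r hr
    have hr : 0 < r := hr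
    -- On a circle the integrand is a derivative in the angle, so its integral over a full turn is
    -- zero.
    have hd : ∀ θ, HasDerivAt (fun θ : ℝ => -r⁻¹ * ψ (x - r • unitVec θ))
        (fderiv ℝ ψ (x - r • unitVec θ) (quarterTurn (unitVec θ))) θ := by
      intro θ
      have h := ((hψ.differentiable one_ne_zero) (x - r • unitVec θ)).hasFDerivAt
      have h' : HasDerivAt (fun θ : ℝ => x - r • unitVec θ) (-(r • quarterTurn (unitVec θ))) θ :=
        ((hasDerivAt_unitVec θ).const_smul r).const_sub x
      have h3 := (h.comp_hasDerivAt θ h').const_mul (-r⁻¹)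
      rw [map_neg, map_smul, neg_mul_neg, smul_eq_mul, inv_mul_cancel_left₀ hr.ne'] at h3
      exact h3
    have hu := continuous_unitVec
    have hcont : Continuous fun θ => fderiv ℝ ψ (x - r • unitVec θ) (quarterTurn (unitVec θ)) :=
      (continuous_fderiv_apply_pair hψ).comp (by
        have := continuous_quarterTurn.comp continuous_unitVec
        fun_prop : Continuous fun θ => (x - r • unitVec θ, quarterTurn (unitVec θ)))
    rw [← integral_Ioc_eq_integral_Ioo, ← intervalIntegral.integral_of_le (by linarith [pi_pos]),
      intervalIntegral.integral_eq_sub_of_hasDerivAt (fun θ _ => hd θ)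
        (hcont.intervalIntegrable _ _)]
    simp [unitVec]
  rw [setIntegral_congr_fun measurableSet_Ioi h2]
  simp

end Polar

/-! ### Potentials solving `Δψ = ∂_a φ`, and Newtonian fields of measures. -/

section GradientPotential

open Metric Filter Topology InnerProductSpace Real

variable {φ ψ : Plane → ℝ}

lemma fderiv_fderiv_apply (hφ : ContDiff ℝ 2 φ) (w v a : Plane) :
    fderiv ℝ (fun y => fderiv ℝ φ y a) w v = fderiv ℝ (fderiv ℝ φ) w v a := by
  have hd : DifferentiableAt ℝ (fderiv ℝ φ) w :=
    ((hφ.fderiv_right (m := 1) (by norm_num)).differentiable one_ne_zero) w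
  rw [fderiv_clm_apply hd (differentiableAt_const a)]
  simp

lemma laplacian_plane_eq (φ : Plane → ℝ) (w : Plane) :
    Laplacian.laplacian φ w = ∑ i, fderiv ℝ (fderiv ℝ φ) w (EuclideanSpace.single i 1)
      (EuclideanSpace.single i 1) := by
  rw [laplacian_eq_iteratedFDeriv_orthonormalBasis _ (EuclideanSpace.basisFun (Fin 2) ℝ)]
  simp [iteratedFDeriv_two_apply]

lemma plane_eq_sum (z : Plane) :
    z = z 0 • EuclideanSpace.single 0 1 + z 1 • EuclideanSpace.single 1 1 := by
  ext i; fin_cases i <;> simp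

/-- For a symmetric form `B` on the plane and the quarter turn `J`, one has `JᵀBJ = tr(B) I - B`.
Against the kernel, the first term gives `∂_a φ` (divergence) and the second vanishes (curl). -/
lemma inner_mul_laplacian (hφ : ContDiff ℝ 2 φ) (a z w : Plane) :
    ⟪a, z⟫_ℝ * Laplacian.laplacian φ w = fderiv ℝ (fun y => fderiv ℝ φ y a) w z +
      fderiv ℝ (fun y => fderiv ℝ φ y (quarterTurn a)) w (quarterTurn z) := by
  rw [fderiv_fderiv_apply hφ, fderiv_fderiv_apply hφ, laplacian_plane_eq]
  have hs : IsSymmSndFDerivAt ℝ φ w := hφ.contDiffAt.isSymmSndFDerivAt (by simp)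
  set B := fderiv ℝ (fderiv ℝ φ) w
  have hB := hs.eq (EuclideanSpace.single 0 1) (EuclideanSpace.single 1 1)
  have e1 : B z a = B (z 0 • EuclideanSpace.single 0 1 + z 1 • EuclideanSpace.single 1 1)
      (a 0 • EuclideanSpace.single 0 1 + a 1 • EuclideanSpace.single 1 1) := by
    rw [← plane_eq_sum, ← plane_eq_sum]
  have e2 : B (quarterTurn z) (quarterTurn a) =
      B (-z 1 • EuclideanSpace.single 0 1 + z 0 • EuclideanSpace.single 1 1)
      (-a 1 • EuclideanSpace.single 0 1 + a 0 • EuclideanSpace.single 1 1) := by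
    congr 1
    · congr 1
      rw [plane_eq_sum (quarterTurn z)]; simp [quarterTurn]
    · rw [plane_eq_sum (quarterTurn a)]; simp [quarterTurn]
  rw [e1, e2]
  simp only [map_add, map_smul, add_apply, smul_apply, smul_eq_mul, Fin.sum_univ_two,
    PiLp.inner_apply, RCLike.inner_apply, conj_trivial]
  simp only [B] at hB ⊢
  rw [hB]
  ring

lemma integrable_kernel_mul_fderiv (hψ : ContDiff ℝ 1 ψ) (hc : HasCompactSupport ψ) (x : Plane)
    {T : Plane → Plane} (hT : Continuous T) (hTn : ∀ z, ‖T z‖ = ‖z‖) :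
    Integrable (fun z => (2 * π * ‖z‖ ^ 2)⁻¹ * fderiv ℝ ψ (x - z) (T z)) := by
  have hcf : Continuous fun z => ‖fderiv ℝ ψ (x - z)‖ :=
    ((hψ.continuous_fderiv one_ne_zero).comp (continuous_const.sub continuous_id)).norm
  have hcs : HasCompactSupport fun z => ‖fderiv ℝ ψ (x - z)‖ :=
    ((hc.fderiv ℝ).comp_homeomorph (Homeomorph.subLeft x)).norm
  refine (locallyIntegrable_gradKernel.integrable_smul_left_of_hasCompactSupport
    hcf hcs).mono ?_ (Eventually.of_forall fun z => ?_)
  · have h1 : Continuous fun z => fderiv ℝ ψ (x - z) (T z) :=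
      ((hψ.continuous_fderiv one_ne_zero).comp (continuous_const.sub continuous_id)).clm_apply hT
    have h2 : Measurable fun z : Plane => (2 * π * ‖z‖ ^ 2)⁻¹ := by fun_prop
    exact h2.aestronglyMeasurable.mul h1.aestronglyMeasurable
  · rw [gradKernel, norm_mul, norm_smul, norm_norm, norm_smul]
    calc _ ≤ ‖(2 * π * ‖z‖ ^ 2)⁻¹‖ * (‖fderiv ℝ ψ (x - z)‖ * ‖z‖) := by
          gcongr
          rw [← hTn z]
          exact (fderiv ℝ ψ (x - z)).le_opNorm _
      _ = _ := by ring

lemma integral_inner_gradKernel_mul_laplacian (hφ : ContDiff ℝ 2 φ) (hc : HasCompactSupport φ)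
    (a x : Plane) :
    ∫ z, ⟪a, gradKernel z⟫_ℝ * Laplacian.laplacian φ (x - z) = fderiv ℝ φ x a := by
  have hd : ∀ v, ContDiff ℝ 1 fun y => fderiv ℝ φ y v := fun v =>
    (hφ.fderiv_right (m := 1) (by norm_num)).clm_apply contDiff_const
  have hdc : ∀ v, HasCompactSupport fun y => fderiv ℝ φ y v := fun v => hc.fderiv_apply ℝ v
  have h1 : ∀ z, ⟪a, gradKernel z⟫_ℝ * Laplacian.laplacian φ (x - z) =
      (2 * π * ‖z‖ ^ 2)⁻¹ * fderiv ℝ (fun y => fderiv ℝ φ y a) (x - z) z +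
      (2 * π * ‖z‖ ^ 2)⁻¹ *
        fderiv ℝ (fun y => fderiv ℝ φ y (quarterTurn a)) (x - z) (quarterTurn z) := by
    intro z
    rw [gradKernel, real_inner_smul_right, mul_assoc, inner_mul_laplacian hφ, mul_add]
  simp_rw [h1]
  rw [integral_add (integrable_kernel_mul_fderiv (hd a) (hdc a) x (T := fun z => z) continuous_id
      fun _ => rfl)
    (integrable_kernel_mul_fderiv (hd _) (hdc _) x continuous_quarterTurn norm_quarterTurn),
    integral_fderiv_gradKernel (hd a) (hdc a), integral_fderiv_quarterTurn (hd _) (hdc _), add_zero]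

/-- The convolution of `φ` with a component of the gradient kernel. -/
noncomputable def gradConv (a : Plane) (φ : Plane → ℝ) : Plane → ℝ :=
  MeasureTheory.convolution (fun z => ⟪a, gradKernel z⟫_ℝ) φ (ContinuousLinearMap.lsmul ℝ ℝ) volume

lemma gradConv_apply (a : Plane) (φ : Plane → ℝ) (x : Plane) :
    gradConv a φ x = ∫ z, ⟪a, gradKernel z⟫_ℝ * φ (x - z) := rfl

lemma locallyIntegrable_inner_gradKernel (a : Plane) :
    LocallyIntegrable (fun z => ⟪a, gradKernel z⟫_ℝ) (volume : Measure Plane) := by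
  intro x
  obtain ⟨s, hs, hi⟩ := locallyIntegrable_gradKernel x
  exact ⟨s, hs, hi.const_inner a⟩

lemma contDiff_gradConv (a : Plane) (hφ : ContDiff ℝ 2 φ) (hc : HasCompactSupport φ) :
    ContDiff ℝ 2 (gradConv a φ) :=
  hc.contDiff_convolution_right (n := 2) _ (locallyIntegrable_inner_gradKernel a) hφ

lemma fderiv_gradConv (a : Plane) (hψ : ContDiff ℝ 1 ψ) (hc : HasCompactSupport ψ) (v : Plane) :
    (fun y => fderiv ℝ (gradConv a ψ) y v) = gradConv a fun y => fderiv ℝ ψ y v := by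
  ext y
  rw [gradConv, (hc.hasFDerivAt_convolution_right _ (locallyIntegrable_inner_gradKernel a)
    hψ y).fderiv]
  exact convolution_precompR_apply _ (locallyIntegrable_inner_gradKernel a) (hc.fderiv ℝ)
    (hψ.continuous_fderiv one_ne_zero) y v

/-- All derivatives fall on `φ`, which reduces the claim to
`integral_inner_gradKernel_mul_laplacian`. This makes `gradConv a φ` the dual test function
detecting the `a`-component of the gradient of `u`. -/
lemma laplacian_gradConv (a : Plane) (hφ : ContDiff ℝ 2 φ) (hc : HasCompactSupport φ)
    (x : Plane) : Laplacian.laplacian (gradConv a φ) x = fderiv ℝ φ x a := by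
  rw [← integral_inner_gradKernel_mul_laplacian hφ hc, laplacian_plane_eq]
  have hd : ∀ v, ContDiff ℝ 1 fun y => fderiv ℝ φ y v := fun v =>
    (hφ.fderiv_right (m := 1) (by norm_num)).clm_apply contDiff_const
  have h1 : ∀ v, fderiv ℝ (fderiv ℝ (gradConv a φ)) x v v =
      gradConv a (fun y => fderiv ℝ (fun y => fderiv ℝ φ y v) y v) x := by
    intro v
    rw [← fderiv_fderiv_apply (contDiff_gradConv a hφ hc), fderiv_gradConv a
      (hφ.of_le (by norm_num)) hc, ← fderiv_gradConv a (hd v) (hc.fderiv_apply ℝ v)]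
  simp_rw [h1, gradConv_apply]
  rw [← integral_finsetSum]
  · congr 1
    ext z
    rw [laplacian_plane_eq, Finset.mul_sum]
    simp_rw [fderiv_fderiv_apply hφ]
  · intro i _
    have := HasCompactSupport.convolutionExists_right (μ := volume)
      (ContinuousLinearMap.lsmul ℝ ℝ) ((hc.fderiv_apply ℝ (EuclideanSpace.single i 1)).fderiv_apply
        ℝ (EuclideanSpace.single i 1)) (locallyIntegrable_inner_gradKernel a)
      (((hd (EuclideanSpace.single i 1)).continuous_fderiv one_ne_zero).clm_apply continuous_const) x
    exact this

/-- The Newtonian field of a measure. -/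
noncomputable def newtonField (μ : Measure Plane) (y : Plane) : Plane :=
  ∫ x, gradKernel (y - x) ∂μ

variable (μ : Measure Plane) [IsFiniteMeasure μ]

lemma stronglyMeasurable_newtonField : StronglyMeasurable (newtonField μ) := by
  have : StronglyMeasurable fun p : Plane × Plane => gradKernel (p.1 - p.2) :=
    (measurable_gradKernel.comp (measurable_fst.sub measurable_snd)).stronglyMeasurable
  exact this.integral_prod_right

/-- Tonelli, with a kernel bound independent of `x`. Where the kernel is not `μ`-integrable the
field is `0` by convention, which does not harm the estimate. -/
lemma setLIntegral_newtonField_le (E : Set Plane) (hE : volume E ≠ ⊤) :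
    ∫⁻ y in E, ‖newtonField μ y‖ₑ ≤ ENNReal.ofReal √((volume E).toReal / π) * μ univ := by
  calc ∫⁻ y in E, ‖newtonField μ y‖ₑ ≤ ∫⁻ y in E, ∫⁻ x, ‖gradKernel (y - x)‖ₑ ∂μ :=
        lintegral_mono fun y => enorm_integral_le_lintegral_enorm _
    _ = ∫⁻ x, (∫⁻ y in E, ‖gradKernel (y - x)‖ₑ) ∂μ := by
      refine lintegral_lintegral_swap ?_
      exact (measurable_gradKernel.comp
        (measurable_fst.sub measurable_snd)).enorm.aemeasurable
    _ ≤ ∫⁻ x, ENNReal.ofReal √((volume E).toReal / π) ∂μ :=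
      lintegral_mono fun x => setLIntegral_gradKernel_le E hE x
    _ = _ := lintegral_const _

/-- Uniformity in `x` serves twice: for Fubini against finite measures, and for the boundedness of
`gradConv a φ`, which need not have compact support. -/
lemma exists_bound_lintegral_smul_gradKernel (hφ : Continuous φ) (hc : HasCompactSupport φ) :
    ∃ B : ℝ≥0∞, B ≠ ⊤ ∧ ∀ x, ∫⁻ y, ‖φ y • gradKernel (y - x)‖ₑ ≤ B := by
  obtain ⟨M, hM⟩ := hφ.bounded_above_of_compact_support hc
  refine ⟨ENNReal.ofReal M * ENNReal.ofReal √((volume (tsupport φ)).toReal / π),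
    ENNReal.mul_ne_top ENNReal.ofReal_ne_top ENNReal.ofReal_ne_top, fun x => ?_⟩
  calc ∫⁻ y, ‖φ y • gradKernel (y - x)‖ₑ
      = ∫⁻ y in tsupport φ, ‖φ y • gradKernel (y - x)‖ₑ := by
        refine (setLIntegral_eq_of_support_subset ?_).symm
        intro y hy
        by_contra hn
        exact hy (by simp [image_eq_zero_of_notMem_tsupport hn])
    _ ≤ ∫⁻ y in tsupport φ, ENNReal.ofReal M * ‖gradKernel (y - x)‖ₑ := by
        refine lintegral_mono fun y => ?_
        rw [enorm_smul, ← ofReal_norm (φ y)]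
        gcongr
        exact hM y
    _ = ENNReal.ofReal M * ∫⁻ y in tsupport φ, ‖gradKernel (y - x)‖ₑ :=
        lintegral_const_mul' _ _ ENNReal.ofReal_ne_top
    _ ≤ _ := by
        gcongr
        exact setLIntegral_gradKernel_le _ hc.isCompact.measure_lt_top.ne x

lemma integrable_smul_gradKernel_prod (hφ : Continuous φ) (hc : HasCompactSupport φ) :
    Integrable (fun p : Plane × Plane => φ p.2 • gradKernel (p.2 - p.1)) (μ.prod volume) := by
  have hm : Measurable fun p : Plane × Plane => φ p.2 • gradKernel (p.2 - p.1) :=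
    (hφ.measurable.comp measurable_snd).smul
      (measurable_gradKernel.comp (measurable_snd.sub measurable_fst))
  obtain ⟨B, hB, hBx⟩ := exists_bound_lintegral_smul_gradKernel hφ hc
  refine ⟨hm.aestronglyMeasurable, ?_⟩
  rw [HasFiniteIntegral, lintegral_prod _ hm.enorm.aemeasurable]
  calc _ ≤ ∫⁻ x, B ∂μ := lintegral_mono hBx
    _ = B * μ univ := lintegral_const _
    _ < ⊤ := ENNReal.mul_lt_top hB.lt_top (measure_lt_top _ _)

/-- The sign comes from the oddness of the kernel and becomes the minus sign of integration by
parts. -/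
lemma gradConv_eq_neg_inner (hφ : Continuous φ) (hc : HasCompactSupport φ) (a x : Plane) :
    gradConv a φ x = -⟪a, ∫ y, φ y • gradKernel (y - x)⟫_ℝ := by
  obtain ⟨B, hB, hBx⟩ := exists_bound_lintegral_smul_gradKernel hφ hc
  have hm : Measurable fun y => φ y • gradKernel (y - x) :=
    hφ.measurable.smul (measurable_gradKernel.comp (measurable_id.sub measurable_const))
  have hi : Integrable fun y => φ y • gradKernel (y - x) :=
    ⟨hm.aestronglyMeasurable, (hBx x).trans_lt hB.lt_top⟩
  rw [← integral_inner hi, ← integral_neg, gradConv_apply,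
    ← integral_sub_left_eq_self (fun z => ⟪a, gradKernel z⟫_ℝ * φ (x - z)) volume x]
  congr 1
  ext y
  rw [sub_sub_cancel, real_inner_smul_right, ← neg_sub y x, gradKernel_neg, inner_neg_right]
  ring

lemma exists_bound_gradConv (hφ : Continuous φ) (hc : HasCompactSupport φ) (a : Plane) :
    ∃ C, ∀ x, ‖gradConv a φ x‖ ≤ C := by
  obtain ⟨B, hB, hBx⟩ := exists_bound_lintegral_smul_gradKernel hφ hc
  refine ⟨‖a‖ * B.toReal, fun x => ?_⟩
  rw [gradConv_eq_neg_inner hφ hc, norm_neg]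
  refine (norm_inner_le_norm _ _).trans ?_
  gcongr
  rw [← toReal_enorm]
  exact ENNReal.toReal_mono hB ((enorm_integral_le_lintegral_enorm _).trans (hBx x))

lemma integrable_smul_newtonField (hφ : Continuous φ) (hc : HasCompactSupport φ) :
    Integrable (fun y => φ y • newtonField μ y) := by
  have := (integrable_smul_gradKernel_prod μ hφ hc).integral_prod_right
  simp_rw [integral_smul] at this
  exact this

lemma integral_gradConv (hφ : Continuous φ) (hc : HasCompactSupport φ) (a : Plane) :
    ∫ x, gradConv a φ x ∂μ = -⟪a, ∫ y, φ y • newtonField μ y⟫_ℝ := by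
  have hi := integrable_smul_gradKernel_prod μ hφ hc
  simp_rw [gradConv_eq_neg_inner hφ hc]
  rw [integral_neg, integral_inner hi.integral_prod_left, integral_integral_swap hi]
  simp_rw [integral_smul]
  rfl

end GradientPotential

/-! ### From integrals over sets to the Lorentz norm. -/

section LorentzBound

open Filter Topology

variable {α : Type*} [MeasurableSpace α] {F : Type*} [NormedAddCommGroup F]

/-- Chebyshev on the level set `E` at height `λ`: `λ |E| ≤ c √|E|` forces `√|E| ≤ c/λ`. -/
lemma decreasingRearrangement_le_of_setLIntegral_le {μ : Measure α} [IsFiniteMeasure μ] {g : α → F}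
    (hg : AEStronglyMeasurable g μ) {c : ℝ} (hc : 0 ≤ c)
    (h : ∀ E : Set α, ∫⁻ x in E, ‖g x‖ₑ ∂μ ≤ ENNReal.ofReal (c * √(μ E).toReal))
    {s : ℝ} (hs : 0 < s) :
    decreasingRearrangement g μ s ≤ ENNReal.ofReal (c / √s) := by
  refine ENNReal.le_of_forall_pos_le_add fun ε hε _ => sInf_le ?_
  have hss : 0 < √s := Real.sqrt_pos.2 hs
  have hε' : (0 : ℝ) < ε := hε
  rw [← ENNReal.ofReal_coe_nnreal, ← ENNReal.ofReal_add (by positivity) hε'.le]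
  -- The slack `ε` keeps the level positive even when `c = 0`.
  set lam : ℝ := c / √s + ε
  have hlam : 0 < lam := by positivity
  set E : Set α := {x | ENNReal.ofReal lam < ‖g x‖ₑ}
  have hE : NullMeasurableSet E μ := nullMeasurableSet_lt aemeasurable_const hg.enorm
  set m := (μ E).toReal
  have hm : μ E = ENNReal.ofReal m := (ENNReal.ofReal_toReal (measure_ne_top _ _)).symm
  have h1 : ENNReal.ofReal lam * μ E ≤ ENNReal.ofReal (c * √m) := by
    rw [← setLIntegral_const]
    refine le_trans (lintegral_mono_ae ?_) (h E)
    filter_upwards [ae_restrict_mem₀ hE] with x hx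
    exact le_of_lt hx
  have hm0 : 0 ≤ m := ENNReal.toReal_nonneg
  rw [hm, ← ENNReal.ofReal_mul hlam.le, ENNReal.ofReal_le_ofReal_iff (by positivity)] at h1
  show μ E ≤ ENNReal.ofReal s
  rw [hm]
  refine ENNReal.ofReal_le_ofReal ?_
  by_contra! hlt
  have h2 : √s < √m := Real.sqrt_lt_sqrt hs.le hlt
  have h3 : lam * √m ≤ c := by
    have : lam * m = lam * √m * √m := by rw [mul_assoc, Real.mul_self_sqrt hm0]
    rw [this] at h1
    exact le_of_mul_le_mul_right h1 (hss.trans h2)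
  have h4 : c < lam * √s := by
    have : lam * √s = c + ε * √s := by simp only [lam]; field_simp
    rw [this]; linarith [mul_pos hε' hss]
  have h5 : lam * √s < lam * √m := mul_lt_mul_of_pos_left h2 hlam
  linarith

lemma setLIntegral_div_sqrt {c t : ℝ} (hc : 0 ≤ c) (ht : 0 < t) :
    ∫⁻ s in Ioo (0 : ℝ) t, ENNReal.ofReal (c / √s) = ENNReal.ofReal (2 * c * √t) := by
  have hint : IntervalIntegrable (fun s : ℝ => c * s ^ (-(1 / 2) : ℝ)) volume 0 t :=
    (intervalIntegral.intervalIntegrable_rpow' (by norm_num)).const_mul c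
  have heq : ∀ s ∈ Ioo (0 : ℝ) t, ENNReal.ofReal (c / √s) =
      ENNReal.ofReal (c * s ^ (-(1 / 2) : ℝ)) := by
    intro s hs
    rw [Real.rpow_neg hs.1.le, ← Real.sqrt_eq_rpow, div_eq_mul_inv]
  have hI : IntegrableOn (fun s : ℝ => c * s ^ (-(1 / 2) : ℝ)) (Ioo 0 t) :=
    ((intervalIntegrable_iff_integrableOn_Ioc_of_le ht.le).1 hint).mono_set Ioo_subset_Ioc_self
  rw [setLIntegral_congr_fun measurableSet_Ioo heq, ← ofReal_integral_eq_lintegral_ofReal hI ?_,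
    ← integral_Ioc_eq_integral_Ioo, ← intervalIntegral.integral_of_le ht.le,
    intervalIntegral.integral_const_mul, integral_rpow (Or.inl (by norm_num))]
  · congr 1
    rw [Real.sqrt_eq_rpow]
    norm_num
    ring
  · filter_upwards [ae_restrict_mem measurableSet_Ioo] with s hs
    exact mul_nonneg hc (Real.rpow_nonneg hs.1.le _)

/-- The factor 2 arises from `∫₀ᵗ c/√s ds = 2c√t`. -/
theorem lorentzTwoInftyNorm_le_of_setLIntegral_le {μ : Measure α} [IsFiniteMeasure μ] {g : α → F}
    (hg : AEStronglyMeasurable g μ) {c : ℝ} (hc : 0 ≤ c)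
    (h : ∀ E : Set α, ∫⁻ x in E, ‖g x‖ₑ ∂μ ≤ ENNReal.ofReal (c * √(μ E).toReal)) :
    lorentzTwoInftyNorm g μ ≤ ENNReal.ofReal (2 * c) := by
  refine iSup₂_le fun t ht => ?_
  have hst : 0 < √t := Real.sqrt_pos.2 ht
  have h1 : maximalRearrangement g μ t ≤ ENNReal.ofReal (2 * c * √t) / ENNReal.ofReal t := by
    rw [maximalRearrangement, ← setLIntegral_div_sqrt hc ht]
    refine ENNReal.div_le_div_right (setLIntegral_mono' measurableSet_Ioo fun s hs => ?_) _
    exact decreasingRearrangement_le_of_setLIntegral_le hg hc h hs.1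
  calc _ ≤ ENNReal.ofReal (√t) * (ENNReal.ofReal (2 * c * √t) / ENNReal.ofReal t) := by gcongr
    _ = ENNReal.ofReal (2 * c) := by
      rw [← ENNReal.ofReal_div_of_pos ht, ← ENNReal.ofReal_mul hst.le]
      congr 1
      rw [mul_div_assoc', show √t * (2 * c * √t) = 2 * c * (√t * √t) by ring,
        Real.mul_self_sqrt ht.le]
      field_simp

end LorentzBound

/-! ### The gradient estimate. -/

open Filter Topology InnerProductSpace in
theorem mainTheorem4 (Ω : Set Plane) (hΩ_open : IsOpen Ω) (hΩ_bdd : Bornology.IsBounded Ω)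
    (n : ℕ) (Γ : Fin n → Set Plane) (hΓ : ∀ i, IsC1JordanCurve (Γ i))
    (hΩ_frontier : frontier Ω = ⋃ i, Γ i)
    (f : Plane → ℝ) (hf : IntegrableOn f Ω volume)
    (u : Plane → ℝ) (hu : IsDirichletSolution Ω f u) :
    ∃ G : Plane → Plane, HasWeakGradient Ω u G ∧
      MemLorentzTwoInfty G (volume.restrict Ω) ∧
      lorentzTwoInftyNorm G (volume.restrict Ω) ≤
        ENNReal.ofReal (3 * √(2 / Real.pi)) * eLpNorm f 1 (volume.restrict Ω) := by
  obtain ⟨μ, ν, hμ, hν, hμm, hνm, hrep⟩ := hu.exists_measures hΩ_open hΩ_bdd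
    (exists_dirichlet_plane hΩ_open hΩ_bdd hΓ hΩ_frontier) hf
  have hNtop : eLpNorm f 1 (volume.restrict Ω) ≠ ⊤ := (memLp_one_iff_integrable.2 hf).2.ne
  set N : ℝ := (eLpNorm f 1 (volume.restrict Ω)).toReal
  have hN0 : 0 ≤ N := ENNReal.toReal_nonneg
  have hN : eLpNorm f 1 (volume.restrict Ω) = ENNReal.ofReal N := (ENNReal.ofReal_toReal hNtop).symm
  have hΩm : volume Ω ≠ ⊤ := hΩ_bdd.measure_lt_top.ne
  have hfin : IsFiniteMeasure (volume.restrict Ω) := isFiniteMeasure_restrict.2 hΩm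
  have hpi := Real.pi_pos
  set G : Plane → Plane := fun y => newtonField μ y - newtonField ν y
  have hGm : StronglyMeasurable G :=
    (stronglyMeasurable_newtonField μ).sub (stronglyMeasurable_newtonField ν)
  have hbound : ∀ E : Set Plane, ∫⁻ x in E, ‖G x‖ₑ ∂(volume.restrict Ω) ≤
      ENNReal.ofReal (2 * N / √Real.pi * √((volume.restrict Ω) E).toReal) := by
    intro E
    have hE : (volume.restrict Ω) E = volume (E ∩ Ω) :=
      Measure.restrict_apply' hΩ_open.measurableSet
    have hEt : volume (E ∩ Ω) ≠ ⊤ := measure_ne_top_of_subset inter_subset_right hΩm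
    rw [hE, Measure.restrict_restrict' hΩ_open.measurableSet]
    calc ∫⁻ x in E ∩ Ω, ‖G x‖ₑ
        ≤ ∫⁻ x in E ∩ Ω, (‖newtonField μ x‖ₑ + ‖newtonField ν x‖ₑ) :=
          lintegral_mono fun x => enorm_sub_le
      _ = (∫⁻ x in E ∩ Ω, ‖newtonField μ x‖ₑ) + ∫⁻ x in E ∩ Ω, ‖newtonField ν x‖ₑ :=
          lintegral_add_left (stronglyMeasurable_newtonField μ).enorm _
      _ ≤ _ := add_le_add (setLIntegral_newtonField_le μ _ hEt)
          (setLIntegral_newtonField_le ν _ hEt)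
      _ = _ := by
          rw [hμm, hνm, hN, ← ENNReal.ofReal_mul (by positivity), ← ENNReal.ofReal_add
            (by positivity) (by positivity), Real.sqrt_div ENNReal.toReal_nonneg]
          congr 1
          ring
  have hGint : IntegrableOn G Ω := by
    refine ⟨hGm.aestronglyMeasurable, ?_⟩
    have := hbound univ
    rw [Measure.restrict_univ] at this
    exact this.trans_lt ENNReal.ofReal_lt_top
  have hnorm : lorentzTwoInftyNorm G (volume.restrict Ω) ≤
      ENNReal.ofReal (3 * √(2 / Real.pi)) * eLpNorm f 1 (volume.restrict Ω) := by
    refine (lorentzTwoInftyNorm_le_of_setLIntegral_le hGm.aestronglyMeasurable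
      (by positivity) hbound).trans ?_
    rw [hN, ← ENNReal.ofReal_mul (by positivity)]
    refine ENNReal.ofReal_le_ofReal ?_
    -- The argument yields `4/√π`; since `16 ≤ 18` this is below `3√2/√π`.
    have h1 : 4 ≤ 3 * √2 := by
      have := Real.sq_sqrt (show (0 : ℝ) ≤ 2 by norm_num)
      nlinarith [Real.sqrt_nonneg 2]
    rw [Real.sqrt_div (by norm_num)]
    calc 2 * (2 * N / √Real.pi) = 4 * (N / √Real.pi) := by ring
      _ ≤ 3 * √2 * (N / √Real.pi) := by gcongr
      _ = _ := by ring
  refine ⟨G, ⟨hu.integrableOn.locallyIntegrableOn, hGint.locallyIntegrableOn, fun φ hφ hc hsupp => ?_⟩,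
    ⟨hGm.aestronglyMeasurable, hnorm.trans_lt (ENNReal.mul_lt_top ENNReal.ofReal_lt_top
      hNtop.lt_top)⟩, hnorm⟩
  have hφ2 : ContDiff ℝ 2 φ := hφ.of_le (WithTop.coe_le_coe.2 (le_top : (2 : ℕ∞) ≤ ⊤))
  have hgc : Continuous (∇ φ) :=
    (InnerProductSpace.toDual ℝ Plane).symm.continuous.comp (hφ2.continuous_fderiv two_ne_zero)
  obtain ⟨M, hM⟩ := hΩ_bdd.isCompact_closure.exists_bound_of_continuousOn hgc.continuousOn
  have hint : IntegrableOn (fun x => u x • ∇ φ x) Ω := by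
    refine MeasureTheory.Integrable.smul_bdd hu.integrableOn M hgc.aestronglyMeasurable ?_
    filter_upwards [ae_restrict_mem hΩ_open.measurableSet] with x hx
    exact hM x (subset_closure hx)
  have hset : ∫ x in Ω, φ x • G x = ∫ x, φ x • G x := by
    refine setIntegral_eq_integral_of_forall_compl_eq_zero fun x hx => ?_
    rw [image_eq_zero_of_notMem_tsupport fun h => hx (hsupp h), zero_smul]
  refine ext_inner_left ℝ fun a => ?_
  rw [← integral_inner hint, hset, inner_neg_right]
  -- Each component of the weak gradient identity becomes the measure representation tested with
  -- `gradConv a φ`.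
  have h1 : ∀ x, ⟪a, u x • ∇ φ x⟫_ℝ = u x * Laplacian.laplacian (gradConv a φ) x := by
    intro x
    rw [laplacian_gradConv a hφ2 hc, real_inner_smul_right, real_inner_comm, gradient,
      InnerProductSpace.toDual_symm_apply]
  simp_rw [h1]
  rw [hrep _ (contDiff_gradConv a hφ2 hc) (exists_bound_gradConv hφ2.continuous hc a),
    integral_gradConv μ hφ2.continuous hc, integral_gradConv ν hφ2.continuous hc]
  simp only [G, smul_sub]
  rw [integral_sub (integrable_smul_newtonField μ hφ2.continuous hc)
    (integrable_smul_newtonField ν hφ2.continuous hc), inner_sub_right]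
  ring
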